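/- Let $k$ be a field and let $A=\bigoplus_{i\in\mathbb{Z}}A^i$ be a differential graded (dg) $k$-algebra, with differential of degree $1$. Let $\mathcal{D}(A)$ be the derived category of (right) dg $A$-modules, that is, the triangulated $k$-linear category obtained from the category of dg $A$-modules by formally inverting all quasi-isomorphisms. Let $\mathrm{per}(A)=\mathrm{thick}(A_A)$ be the smallest triangulated subcategory of $\mathcal{D}(A)$ which contains the dg module $A_A$ and is closed under taking direct summands, and let $\mathcal{D}_{fd}(A)$ be the full subcategory of $\mathcal{D}(A)$ consisting of the dg $A$-modules whose total cohomology is finite-dimensional over $k$. Assume that - $A^i=0$ for every $i>0$, - $H^0(A)$ is finite-dimensional over $k$, - $\mathcal{D}_{fd}(A)\subseteq\mathrm{per}(A)$. Then $H^i(A)$ is finite-dimensional over $k$ for every $i\in\mathbb{Z}$. Consequently, $\mathrm{per}(A)$ is Hom-finite, i.e. $\mathrm{Hom}_{\mathcal{D}(A)}(X,Y)$ is finite-dimensional over $k$ for all $X,Y\in\mathrm{per}(A)$. -/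

import Mathlib

open CategoryTheory CategoryTheory.Limits CategoryTheory.Pretriangulated
open scoped RightActions

universe u v

noncomputable section

/-! ### Graded pieces of internally graded modules -/

section Internal

variable {k : Type u} [CommRing k]

lemma isInternal_shift {M : Type v} [AddCommGroup M] [Module k M] {gr : ℤ → Submodule k M}
    (h : DirectSum.IsInternal gr) (n : ℤ) : DirectSum.IsInternal (fun i => gr (i + n)) := by
  rw [DirectSum.isInternal_submodule_iff_iSupIndep_and_iSup_eq_top] at h ⊢
  refine ⟨h.1.comp (add_left_injective n), ?_⟩
  rw [← h.2]
  exact (Equiv.addRight n).iSup_comp (g := gr)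

lemma isInternal_prod {M N : Type v} [AddCommGroup M] [Module k M] [AddCommGroup N] [Module k N]
    {p : ℤ → Submodule k M} {q : ℤ → Submodule k N}
    (hp : DirectSum.IsInternal p) (hq : DirectSum.IsInternal q) :
    DirectSum.IsInternal (fun i => (p i).prod (q i)) := by
  rw [DirectSum.isInternal_submodule_iff_iSupIndep_and_iSup_eq_top] at hp hq ⊢
  constructor
  · intro i
    have hle : (⨆ (j) (_ : j ≠ i), (p j).prod (q j)) ≤
        (⨆ (j) (_ : j ≠ i), p j).prod (⨆ (j) (_ : j ≠ i), q j) :=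
      iSup₂_le fun j hj => Submodule.prod_mono
        (le_iSup₂ (f := fun j (_ : j ≠ i) => p j) j hj)
        (le_iSup₂ (f := fun j (_ : j ≠ i) => q j) j hj)
    refine Disjoint.mono_right hle ?_
    rw [Submodule.disjoint_def]
    rintro ⟨x, y⟩ ⟨hx, hy⟩ ⟨hx', hy'⟩
    have h1 := (Submodule.disjoint_def.1 (hp.1 i)) x hx hx'
    have h2 := (Submodule.disjoint_def.1 (hq.1 i)) y hy hy'
    rw [h1, h2]
    rfl
  · rw [eq_top_iff]
    rintro ⟨x, y⟩ -
    have hx : (⨆ i, p i) ≤ Submodule.comap (LinearMap.inl k M N) (⨆ i, (p i).prod (q i)) :=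
      iSup_le fun i z hz => Submodule.mem_iSup_of_mem (p := fun i => (p i).prod (q i)) i
        (show (z, (0 : N)) ∈ (p i).prod (q i) from ⟨hz, (q i).zero_mem⟩)
    have hy : (⨆ i, q i) ≤ Submodule.comap (LinearMap.inr k M N) (⨆ i, (p i).prod (q i)) :=
      iSup_le fun i z hz => Submodule.mem_iSup_of_mem (p := fun i => (p i).prod (q i)) i
        (show ((0 : M), z) ∈ (p i).prod (q i) from ⟨(p i).zero_mem, hz⟩)
    rw [hp.2] at hx
    rw [hq.2] at hy
    have hx' : (x, (0 : N)) ∈ ⨆ i, (p i).prod (q i) := hx (Submodule.mem_top (x := x))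
    have hy' : ((0 : M), y) ∈ ⨆ i, (p i).prod (q i) := hy (Submodule.mem_top (x := y))
    simpa using Submodule.add_mem _ hx' hy'

lemma isInternal_punit :
    DirectSum.IsInternal (fun _ : ℤ => (⊥ : Submodule k PUnit.{v + 1})) := by
  rw [DirectSum.isInternal_submodule_iff_iSupIndep_and_iSup_eq_top]
  exact ⟨fun _ => disjoint_bot_left, Subsingleton.elim _ _⟩

end Internal

/-! ### Cohomology of a graded module with a differential of degree one -/

section Cohomology

variable {k : Type u} [CommRing k] {M : Type v} [AddCommGroup M] [Module k M]

/-- The cocycles `Z^i = {m ∈ M^i | d m = 0}`. -/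
def dgCocycles (gr : ℤ → Submodule k M) (d : M →ₗ[k] M) (i : ℤ) : Submodule k M :=
  gr i ⊓ LinearMap.ker d

/-- The coboundaries `B^i = d (M^{i-1})`. -/
def dgCoboundaries (gr : ℤ → Submodule k M) (d : M →ₗ[k] M) (i : ℤ) : Submodule k M :=
  (gr (i - 1)).map d

/-- The cohomology `H^i = Z^i / B^i`. -/
abbrev dgCohomology (gr : ℤ → Submodule k M) (d : M →ₗ[k] M) (i : ℤ) : Type v :=
  dgCocycles gr d i ⧸ (dgCoboundaries gr d i).submoduleOf (dgCocycles gr d i)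

/-- The total cohomology `ker d / im d`. -/
abbrev dgTotalCohomology (d : M →ₗ[k] M) : Type v :=
  LinearMap.ker d ⧸ (LinearMap.range d).submoduleOf (LinearMap.ker d)

end Cohomology

/-! ### Differential graded algebras and modules -/

/-- A dg `k`-algebra: a `ℤ`-graded unital associative `k`-algebra `A = ⨁ A^i` with a `k`-linear
differential of degree one which squares to zero and satisfies the graded Leibniz rule. -/
structure DGAlgebra (k : Type u) [CommRing k] where
  carrier : Type v
  [ring : Ring carrier]
  [algebra : Algebra k carrier]
  gr : ℤ → Submodule k carrier
  isInternal : DirectSum.IsInternal gr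
  one_mem : (1 : carrier) ∈ gr 0
  mul_mem : ∀ {i j : ℤ} {a b : carrier}, a ∈ gr i → b ∈ gr j → a * b ∈ gr (i + j)
  d : carrier →ₗ[k] carrier
  d_mem : ∀ {i : ℤ} {a : carrier}, a ∈ gr i → d a ∈ gr (i + 1)
  d_d : ∀ a, d (d a) = 0
  leibniz : ∀ {i : ℤ} {a : carrier}, a ∈ gr i → ∀ b,
    d (a * b) = d a * b + Int.negOnePow i • (a * d b)

attribute [instance] DGAlgebra.ring DGAlgebra.algebra

/-- The cohomology `H^i(A)` of a dg algebra. -/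
abbrev DGAlgebra.cohomology {k : Type u} [CommRing k] (A : DGAlgebra.{u, v} k) (i : ℤ) : Type v :=
  dgCohomology A.gr A.d i

/-- A (right) dg module over the dg algebra `A`: a `ℤ`-graded right `A`-module `M = ⨁ M^i` with a
differential of degree one which squares to zero and satisfies the graded Leibniz rule. The right
action of `a` on `m` is written `m <• a`. -/
structure DGModule {k : Type u} [CommRing k] (A : DGAlgebra.{u, v} k) where
  carrier : Type v
  [addCommGroup : AddCommGroup carrier]
  [module : Module k carrier]
  [rightModule : Module (A.carrier)ᵐᵒᵖ carrier]
  [isScalarTower : IsScalarTower k (A.carrier)ᵐᵒᵖ carrier]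
  gr : ℤ → Submodule k carrier
  isInternal : DirectSum.IsInternal gr
  smul_mem : ∀ {i j : ℤ} {m : carrier} {a : A.carrier}, m ∈ gr i → a ∈ A.gr j → m <• a ∈ gr (i + j)
  d : carrier →ₗ[k] carrier
  d_mem : ∀ {i : ℤ} {m : carrier}, m ∈ gr i → d m ∈ gr (i + 1)
  d_d : ∀ m, d (d m) = 0
  leibniz : ∀ {i : ℤ} {m : carrier}, m ∈ gr i → ∀ a : A.carrier,
    d (m <• a) = d m <• a + Int.negOnePow i • (m <• A.d a)

attribute [instance] DGModule.addCommGroup DGModule.module DGModule.rightModule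
  DGModule.isScalarTower

namespace DGModule

section Category

variable {k : Type u} [CommRing k] {A : DGAlgebra.{u, v} k}

/-- The right `A`-linear maps which are homogeneous of degree zero and commute with the
differentials, as a `k`-module. -/
def homSubmodule (M N : DGModule A) :
    Submodule k (M.carrier →ₗ[(A.carrier)ᵐᵒᵖ] N.carrier) where
  carrier := {f | (∀ i, ∀ m ∈ M.gr i, f m ∈ N.gr i) ∧ ∀ m, f (M.d m) = N.d (f m)}
  add_mem' hf hg := ⟨fun i m hm => (N.gr i).add_mem (hf.1 i m hm) (hg.1 i m hm),
    fun m => by simp [hf.2, hg.2]⟩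
  zero_mem' := ⟨fun i _ _ => (N.gr i).zero_mem, fun m => by simp⟩
  smul_mem' c _ hf := ⟨fun i m hm => (N.gr i).smul_mem c (hf.1 i m hm),
    fun m => by simp [hf.2]⟩

/-- The category `C(A)` of dg `A`-modules. -/
instance : Category.{v} (DGModule A) where
  Hom M N := homSubmodule M N
  id M := ⟨LinearMap.id, fun _ _ hm => hm, fun _ => rfl⟩
  comp f g := ⟨g.1.comp f.1, fun i m hm => g.2.1 i _ (f.2.1 i m hm), fun m => by
    change g.1 (f.1 _) = _
    rw [f.2.2, g.2.2]
    rfl⟩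

/-- The underlying `A`-linear map of a morphism of dg modules. -/
def Hom.lin {M N : DGModule A} (f : M ⟶ N) : M.carrier →ₗ[(A.carrier)ᵐᵒᵖ] N.carrier := f.1

/-- Constructor for morphisms of dg modules. -/
def Hom.mk {M N : DGModule A} (f : M.carrier →ₗ[(A.carrier)ᵐᵒᵖ] N.carrier)
    (h : ∀ i, ∀ m ∈ M.gr i, f m ∈ N.gr i) (h' : ∀ m, f (M.d m) = N.d (f m)) : M ⟶ N :=
  ⟨f, h, h'⟩

lemma Hom.mem {M N : DGModule A} (f : M ⟶ N) {i : ℤ} {m : M.carrier} (hm : m ∈ M.gr i) :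
    Hom.lin f m ∈ N.gr i := f.2.1 i m hm

lemma Hom.comm {M N : DGModule A} (f : M ⟶ N) (m : M.carrier) :
    Hom.lin f (M.d m) = N.d (Hom.lin f m) := f.2.2 m

lemma Hom.map_smul_base {M N : DGModule A} (f : M ⟶ N) (c : k) (m : M.carrier) :
    Hom.lin f (c • m) = c • Hom.lin f m :=
  (LinearMap.restrictScalars k (Hom.lin f)).map_smul c m

lemma hom_ext {M N : DGModule A} {f g : M ⟶ N} (h : ∀ m, Hom.lin f m = Hom.lin g m) :
    f = g :=
  Subtype.ext (LinearMap.ext h)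

@[simp] lemma lin_mk {M N : DGModule A} (f : M.carrier →ₗ[(A.carrier)ᵐᵒᵖ] N.carrier)
    (h : ∀ i, ∀ m ∈ M.gr i, f m ∈ N.gr i) (h' : ∀ m, f (M.d m) = N.d (f m)) (m : M.carrier) :
    Hom.lin (Hom.mk f h h') m = f m := rfl

@[simp] lemma lin_id (M : DGModule A) (m : M.carrier) : Hom.lin (𝟙 M) m = m := rfl

@[simp] lemma lin_comp {M N P : DGModule A} (f : M ⟶ N) (g : N ⟶ P) (m : M.carrier) :
    Hom.lin (f ≫ g) m = Hom.lin g (Hom.lin f m) := rfl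

instance : Preadditive (DGModule A) where
  homGroup M N := inferInstanceAs (AddCommGroup (homSubmodule M N))
  add_comp _ _ _ f f' g := by
    refine hom_ext fun m => ?_
    exact (Hom.lin g).map_add _ _
  comp_add _ _ _ _ _ _ := rfl

instance : Linear k (DGModule A) where
  homModule M N := inferInstanceAs (Module k (homSubmodule M N))
  smul_comp _ _ _ r f g := by
    refine hom_ext fun m => ?_
    exact Hom.map_smul_base g r _
  comp_smul _ _ _ _ _ _ := rfl

@[simp] lemma lin_add {M N : DGModule A} (f g : M ⟶ N) (m : M.carrier) :
    Hom.lin (f + g) m = Hom.lin f m + Hom.lin g m := rfl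

@[simp] lemma lin_zero {M N : DGModule A} (m : M.carrier) :
    Hom.lin (0 : M ⟶ N) m = 0 := rfl

/-- `A` as a right dg module over itself. -/
def regular (A : DGAlgebra.{u, v} k) : DGModule A where
  carrier := A.carrier
  gr := A.gr
  isInternal := A.isInternal
  smul_mem hm ha := A.mul_mem hm ha
  d := A.d
  d_mem := A.d_mem
  d_d := A.d_d
  leibniz hm a := A.leibniz hm a

/-! ### Zero object and direct sums -/

/-- The zero dg module. -/
def zeroModule (A : DGAlgebra.{u, v} k) : DGModule A where
  carrier := PUnit.{v + 1}
  gr _ := ⊥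
  isInternal := isInternal_punit
  smul_mem _ _ := Subsingleton.elim _ _
  d := 0
  d_mem _ := Subsingleton.elim _ _
  d_d _ := rfl
  leibniz _ _ := rfl

lemma isZero_zeroModule : IsZero (zeroModule A) := by
  rw [IsZero.iff_id_eq_zero]
  refine hom_ext fun _ => ?_
  exact Subsingleton.elim (α := PUnit) _ _

instance : HasZeroObject (DGModule A) := ⟨⟨_, isZero_zeroModule⟩⟩

/-- The direct sum of two dg modules. -/
def prodModule (M N : DGModule A) : DGModule A where
  carrier := M.carrier × N.carrier
  gr i := (M.gr i).prod (N.gr i)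
  isInternal := isInternal_prod M.isInternal N.isInternal
  smul_mem hm ha := ⟨M.smul_mem hm.1 ha, N.smul_mem hm.2 ha⟩
  d := M.d.prodMap N.d
  d_mem hm := ⟨M.d_mem hm.1, N.d_mem hm.2⟩
  d_d _ := Prod.ext (M.d_d _) (N.d_d _)
  leibniz hm a := Prod.ext (M.leibniz hm.1 a) (N.leibniz hm.2 a)

/-- The direct sum, with its projections and injections. -/
def prodBicone (M N : DGModule A) : BinaryBicone M N where
  pt := prodModule M N
  fst := Hom.mk (LinearMap.fst _ _ _) (fun _ _ h => h.1) (fun _ => rfl)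
  snd := Hom.mk (LinearMap.snd _ _ _) (fun _ _ h => h.2) (fun _ => rfl)
  inl := Hom.mk (LinearMap.inl _ _ _) (fun i _ h => ⟨h, (N.gr i).zero_mem⟩)
    (fun _ => Prod.ext rfl N.d.map_zero.symm)
  inr := Hom.mk (LinearMap.inr _ _ _) (fun i _ h => ⟨(M.gr i).zero_mem, h⟩)
    (fun _ => Prod.ext M.d.map_zero.symm rfl)
  inl_fst := rfl
  inl_snd := rfl
  inr_fst := rfl
  inr_snd := rfl

instance : HasBinaryBiproducts (DGModule A) where
  has_binary_biproduct M N := hasBinaryBiproduct_of_total (prodBicone M N) (by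
    refine hom_ext fun _ => ?_
    exact Prod.ext (add_zero _) (zero_add _))

instance : HasFiniteProducts (DGModule A) := hasFiniteProducts_of_has_binary_and_terminal

/-! ### Quasi-isomorphisms -/

lemma Hom.mem_cocycles {M N : DGModule A} (f : M ⟶ N) {i : ℤ} {m : M.carrier}
    (hm : m ∈ dgCocycles M.gr M.d i) : Hom.lin f m ∈ dgCocycles N.gr N.d i :=
  ⟨Hom.mem f hm.1, by
    have h : M.d m = 0 := hm.2
    change N.d _ = 0
    rw [← Hom.comm, h, map_zero]⟩

lemma Hom.mem_coboundaries {M N : DGModule A} (f : M ⟶ N) {i : ℤ} {m : M.carrier}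
    (hm : m ∈ dgCoboundaries M.gr M.d i) : Hom.lin f m ∈ dgCoboundaries N.gr N.d i := by
  obtain ⟨x, hx, rfl⟩ := hm
  exact ⟨Hom.lin f x, Hom.mem f hx, (Hom.comm f x).symm⟩

/-- The cohomology `H^i(M)` of a dg module. -/
abbrev cohomology (M : DGModule A) (i : ℤ) : Type v := dgCohomology M.gr M.d i

/-- The map `H^i(f) : H^i(M) → H^i(N)` induced by a morphism `f : M ⟶ N`. -/
def cohomologyMap {M N : DGModule A} (f : M ⟶ N) (i : ℤ) :
    M.cohomology i →ₗ[k] N.cohomology i :=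
  Submodule.mapQ _ _
    (((Hom.lin f).restrictScalars k).restrict fun _ hm => Hom.mem_cocycles f hm)
    fun _ hm => Hom.mem_coboundaries f hm

variable (A) in
/-- The quasi-isomorphisms: the morphisms which induce bijections in cohomology. -/
def quasiIso : MorphismProperty (DGModule A) :=
  fun _ _ f => ∀ i : ℤ, Function.Bijective (cohomologyMap f i)

lemma cohomologyMap_id (M : DGModule A) (i : ℤ) : cohomologyMap (𝟙 M) i = LinearMap.id := by
  ext; rfl

lemma cohomologyMap_comp {M N P : DGModule A} (f : M ⟶ N) (g : N ⟶ P) (i : ℤ) :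
    cohomologyMap (f ≫ g) i = (cohomologyMap g i).comp (cohomologyMap f i) := by
  ext; rfl

instance : (quasiIso A).IsMultiplicative where
  id_mem M i := by
    rw [cohomologyMap_id]
    exact Function.bijective_id
  comp_mem f g hf hg i := by
    rw [cohomologyMap_comp]
    exact (hg i).comp (hf i)

lemma quasiIso_iff {M N : DGModule A} (f : M ⟶ N) : quasiIso A f ↔ ∀ i : ℤ,
    (∀ m ∈ dgCocycles M.gr M.d i, Hom.lin f m ∈ dgCoboundaries N.gr N.d i →
      m ∈ dgCoboundaries M.gr M.d i) ∧
    ∀ n ∈ dgCocycles N.gr N.d i, ∃ m ∈ dgCocycles M.gr M.d i,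
      n - Hom.lin f m ∈ dgCoboundaries N.gr N.d i := by
  have key : ∀ (P : DGModule A) (i : ℤ) (z : dgCocycles P.gr P.d i),
      (Submodule.Quotient.mk z : P.cohomology i) = 0 ↔ z.1 ∈ dgCoboundaries P.gr P.d i :=
    fun _ _ _ => Submodule.Quotient.mk_eq_zero _
  have key' : ∀ (P : DGModule A) (i : ℤ) (z z' : dgCocycles P.gr P.d i),
      (Submodule.Quotient.mk z : P.cohomology i) = Submodule.Quotient.mk z' ↔
        z.1 - z'.1 ∈ dgCoboundaries P.gr P.d i :=
    fun _ _ _ _ => Submodule.Quotient.eq _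
  have hmk : ∀ (i : ℤ) (z : dgCocycles M.gr M.d i), cohomologyMap f i (Submodule.Quotient.mk z) =
      Submodule.Quotient.mk ⟨Hom.lin f z.1, Hom.mem_cocycles f z.2⟩ := fun _ _ => rfl
  refine forall_congr' fun i => and_congr ?_ ?_
  · rw [injective_iff_map_eq_zero]
    constructor
    · intro h m hm hfm
      refine (key M i ⟨m, hm⟩).1 (h _ ?_)
      rw [hmk]
      exact (key N i _).2 hfm
    · intro h x
      obtain ⟨⟨m, hm⟩, rfl⟩ := Submodule.Quotient.mk_surjective _ x
      intro hx
      rw [hmk] at hx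
      exact (key M i _).2 (h m hm ((key N i _).1 hx))
  · constructor
    · intro h n hn
      obtain ⟨x, hx⟩ := h (Submodule.Quotient.mk ⟨n, hn⟩)
      obtain ⟨⟨m, hm⟩, rfl⟩ := Submodule.Quotient.mk_surjective _ x
      rw [hmk] at hx
      exact ⟨m, hm, (key' N i _ _).1 hx.symm⟩
    · intro h y
      obtain ⟨⟨n, hn⟩, rfl⟩ := Submodule.Quotient.mk_surjective _ y
      obtain ⟨m, hm, hmn⟩ := h n hn
      refine ⟨Submodule.Quotient.mk ⟨m, hm⟩, ?_⟩
      rw [hmk]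
      exact ((key' N i _ _).2 hmn).symm

instance : (quasiIso A).RespectsIso :=
  MorphismProperty.respectsIso_of_isStableUnderComposition fun M N f hf => by
    have : IsIso f := hf
    intro i
    refine Function.bijective_iff_has_inverse.2 ⟨cohomologyMap (inv f) i, fun x => ?_, fun x => ?_⟩
    · rw [← LinearMap.comp_apply, ← cohomologyMap_comp, IsIso.hom_inv_id, cohomologyMap_id]
      rfl
    · rw [← LinearMap.comp_apply, ← cohomologyMap_comp, IsIso.inv_hom_id, cohomologyMap_id]
      rfl

lemma lin_sum {M N : DGModule A} {J : Type} (s : Finset J) (f : J → (M ⟶ N)) (m : M.carrier) :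
    Hom.lin (∑ j ∈ s, f j) m = ∑ j ∈ s, Hom.lin (f j) m := by
  classical
  induction s using Finset.induction_on with
  | empty => simp
  | insert a s ha ih => rw [Finset.sum_insert ha, Finset.sum_insert ha, lin_add, ih]

/-- The inclusion of a factor in a finite product. -/
def piInj {J : Type} (X : J → DGModule A) [HasProduct X] (j : J) : X j ⟶ ∏ᶜ X := by
  classical
  exact Pi.lift fun i => if h : j = i then eqToHom (by rw [h]) else 0

lemma piInj_π {J : Type} (X : J → DGModule A) [HasProduct X] (j : J) :
    piInj X j ≫ Pi.π X j = 𝟙 _ := by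
  simp [piInj]

lemma piInj_π_ne {J : Type} (X : J → DGModule A) [HasProduct X] {i j : J} (h : i ≠ j) :
    piInj X i ≫ Pi.π X j = 0 := by
  simp [piInj, h]

lemma piInj_map {J : Type} {X Y : J → DGModule A} [HasProduct X] [HasProduct Y]
    (f : ∀ j, X j ⟶ Y j) (j : J) : piInj X j ≫ Limits.Pi.map f = f j ≫ piInj Y j := by
  apply Pi.hom_ext
  intro b
  rw [Category.assoc, Category.assoc, Limits.Pi.map_π]
  by_cases h : j = b
  · subst h
    rw [← Category.assoc, piInj_π, piInj_π, Category.id_comp, Category.comp_id]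
  · rw [← Category.assoc, piInj_π_ne X h, piInj_π_ne Y h, zero_comp, comp_zero]

lemma eq_sum_piInj {J : Type} [Fintype J] (X : J → DGModule A) [HasProduct X]
    (m : (∏ᶜ X).carrier) : m = ∑ j, Hom.lin (piInj X j) (Hom.lin (Pi.π X j) m) := by
  have h : 𝟙 (∏ᶜ X) = ∑ j, Pi.π X j ≫ piInj X j := by
    apply Pi.hom_ext
    intro b
    rw [Preadditive.sum_comp, Finset.sum_eq_single b]
    · rw [Category.assoc, piInj_π, Category.comp_id, Category.id_comp]
    · intro j _ hj
      rw [Category.assoc, piInj_π_ne X hj, comp_zero]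
    · simp
  conv_lhs => rw [← lin_id _ m, h, lin_sum]
  rfl

instance : (quasiIso A).IsStableUnderFiniteProducts where
  isStableUnderProductsOfShape J _ := MorphismProperty.IsStableUnderProductsOfShape.mk _ J (by
    have := Fintype.ofFinite J
    intro X Y _ _ f hf
    have hπ : ∀ j (m : (∏ᶜ X).carrier), Hom.lin (Pi.π Y j) (Hom.lin (Limits.Pi.map f) m) =
        Hom.lin (f j) (Hom.lin (Pi.π X j) m) := fun j m => by
      rw [← lin_comp, ← lin_comp, Limits.Pi.map_π]
    simp only [quasiIso_iff] at hf ⊢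
    intro i
    refine ⟨fun m hm hfm => ?_, fun n hn => ?_⟩
    · rw [eq_sum_piInj X m]
      refine Submodule.sum_mem _ fun j _ => Hom.mem_coboundaries _ ?_
      refine (hf j i).1 _ (Hom.mem_cocycles _ hm) ?_
      rw [← hπ]
      exact Hom.mem_coboundaries _ hfm
    · choose x hx hx' using fun j => (hf j i).2 _ (Hom.mem_cocycles (Pi.π Y j) hn)
      refine ⟨∑ j, Hom.lin (piInj X j) (x j),
        Submodule.sum_mem _ fun j _ => Hom.mem_cocycles _ (hx j), ?_⟩
      have : n - Hom.lin (Limits.Pi.map f) (∑ j, Hom.lin (piInj X j) (x j)) =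
          ∑ j, Hom.lin (piInj Y j) (Hom.lin (Pi.π Y j) n - Hom.lin (f j) (x j)) := by
        simp only [map_sub, Finset.sum_sub_distrib, map_sum]
        rw [← eq_sum_piInj Y n]
        congr 1
        refine Finset.sum_congr rfl fun j _ => ?_
        rw [← lin_comp, piInj_map]
        rfl
      rw [this]
      exact Submodule.sum_mem _ fun j _ => Hom.mem_coboundaries _ (hx' j))

/-! ### Shifts -/

lemma negOnePow_smul_mem {M : Type v} [AddCommGroup M] [Module k M] (p : Submodule k M) (n : ℤ)
    {m : M} (hm : m ∈ p) : Int.negOnePow n • m ∈ p := by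
  rcases Int.units_eq_one_or (Int.negOnePow n) with h | h <;> rw [h]
  · rwa [one_smul]
  · rw [Units.neg_smul, one_smul]
    exact p.neg_mem hm

/-- The shift `M[n]`, with `M[n]^i = M^{i+n}` and differential `(-1)^n d`. -/
def shift (M : DGModule A) (n : ℤ) : DGModule A where
  carrier := M.carrier
  gr i := M.gr (i + n)
  isInternal := isInternal_shift M.isInternal n
  smul_mem {i j m a} hm ha := by
    have := M.smul_mem hm ha
    rwa [add_right_comm] at this
  d := Int.negOnePow n • M.d
  d_mem {i m} hm := by
    have := negOnePow_smul_mem _ n (M.d_mem hm)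
    rwa [add_right_comm] at this
  d_d m := by
    change Int.negOnePow n • M.d (Int.negOnePow n • M.d m) = 0
    rcases Int.units_eq_one_or (Int.negOnePow n) with h | h <;> simp [h, M.d_d]
  leibniz {i m} hm a := by
    change Int.negOnePow n • M.d (m <• a) =
      (Int.negOnePow n • M.d m) <• a + Int.negOnePow i • (m <• A.d a)
    rw [M.leibniz hm a, Int.negOnePow_add]
    rcases Int.units_eq_one_or (Int.negOnePow n) with h | h <;> simp [h]

/-- The shift functor `M ↦ M[n]`. -/
def shiftFun (n : ℤ) : DGModule A ⥤ DGModule A where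
  obj M := M.shift n
  map {M N} f := Hom.mk (M := M.shift n) (N := N.shift n) (Hom.lin (M := M) (N := N) f)
    (fun _ _ hm => Hom.mem f hm)
    (fun (m : M.carrier) => by
      change Hom.lin f (Int.negOnePow n • M.d m) = Int.negOnePow n • N.d (Hom.lin f m)
      rw [← Hom.comm]
      rcases Int.units_eq_one_or (Int.negOnePow n) with h | h <;> simp [h])
  map_id _ := rfl
  map_comp _ _ := rfl

/-- An isomorphism between two dg modules with the same underlying module. -/
def isoOfLin {M N : DGModule A} (e : M.carrier ≃ₗ[(A.carrier)ᵐᵒᵖ] N.carrier)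
    (h : ∀ i m, m ∈ M.gr i ↔ e m ∈ N.gr i) (h' : ∀ m, e (M.d m) = N.d (e m)) : M ≅ N where
  hom := Hom.mk e.toLinearMap (fun i m hm => (h i m).1 hm) h'
  inv := Hom.mk e.symm.toLinearMap (fun i m hm => (h i _).2 (by simpa using hm))
    (fun m => e.injective (by simp [h']))
  hom_inv_id := hom_ext fun m => e.symm_apply_apply m
  inv_hom_id := hom_ext fun m => e.apply_symm_apply m

/-- The identification `M[0] ≅ M`. -/
def shiftZeroIso (M : DGModule A) : M.shift 0 ≅ M :=
  isoOfLin (M := M.shift 0) (LinearEquiv.refl _ M.carrier)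
    (fun i m => by
      change m ∈ M.gr (i + 0) ↔ m ∈ M.gr i
      rw [add_zero])
    (fun m => by
      change Int.negOnePow 0 • M.d m = M.d m
      simp)

/-- The identification `M[n + m] ≅ M[n][m]`. -/
def shiftAddIso (M : DGModule A) (n m : ℤ) : M.shift (n + m) ≅ (M.shift n).shift m :=
  isoOfLin (M := M.shift (n + m)) (N := (M.shift n).shift m) (LinearEquiv.refl _ M.carrier)
    (fun i x => by
      change x ∈ M.gr (i + (n + m)) ↔ x ∈ M.gr (i + m + n)
      rw [add_comm n m, add_assoc])
    (fun x => by
      change Int.negOnePow (n + m) • M.d x = Int.negOnePow m • Int.negOnePow n • M.d x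
      rw [smul_smul, Int.negOnePow_add, mul_comm])

lemma shift_hom_eq (M : DGModule A) {n m : ℤ} (h : n = m) {P : DGModule A}
    (h' : M.shift n = M.shift m) (f : M.shift n ⟶ P) (g : M.shift m ⟶ P)
    (hfg : ∀ x : M.carrier, Hom.lin (M := M.shift n) f x = Hom.lin (M := M.shift m) g x) :
    f = eqToHom h' ≫ g := by
  subst h
  rw [eqToHom_refl, Category.id_comp]
  exact hom_ext hfg

variable (A) in
/-- The shift functors and their compatibilities. -/
def shiftMkCore : ShiftMkCore (DGModule A) ℤ where
  F := shiftFun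
  zero := NatIso.ofComponents shiftZeroIso (fun _ => rfl)
  add n m := NatIso.ofComponents (fun M => M.shiftAddIso n m) (fun _ => rfl)
  assoc_hom_app n m p M := shift_hom_eq M (add_assoc n m p) _ _ _ fun _ => rfl
  zero_add_hom_app n M := shift_hom_eq M (zero_add n) _ _ _ fun _ => rfl
  add_zero_hom_app n M := shift_hom_eq M (add_zero n) _ _ _ fun _ => rfl

instance : HasShift (DGModule A) ℤ := hasShiftMk _ _ (shiftMkCore A)

lemma cocycles_shift (M : DGModule A) (n i : ℤ) :
    dgCocycles (M.shift n).gr (M.shift n).d i = dgCocycles M.gr M.d (i + n) := by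
  ext x
  change x ∈ M.gr (i + n) ∧ Int.negOnePow n • M.d x = 0 ↔ x ∈ M.gr (i + n) ∧ M.d x = 0
  rcases Int.units_eq_one_or (Int.negOnePow n) with h | h <;> simp [h]

lemma coboundaries_shift (M : DGModule A) (n i : ℤ) :
    dgCoboundaries (M.shift n).gr (M.shift n).d i = dgCoboundaries M.gr M.d (i + n) := by
  ext x
  have hi : i - 1 + n = i + n - 1 := by ring
  change (∃ y, y ∈ M.gr (i - 1 + n) ∧ Int.negOnePow n • M.d y = x) ↔
    ∃ y, y ∈ M.gr (i + n - 1) ∧ M.d y = x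
  rw [hi]
  rcases Int.units_eq_one_or (Int.negOnePow n) with h | h <;> rw [h]
  · simp
  · constructor
    · rintro ⟨y, hy, rfl⟩
      exact ⟨-y, Submodule.neg_mem _ hy, by simp⟩
    · rintro ⟨y, hy, rfl⟩
      exact ⟨-y, Submodule.neg_mem _ hy, by simp⟩

instance : (quasiIso A).IsCompatibleWithShift ℤ where
  condition n := by
    ext M N f
    change quasiIso A ((shiftFun n).map f) ↔ quasiIso A f
    simp only [quasiIso_iff]
    constructor
    · intro h i
      have := h (i - n)
      change (∀ m ∈ dgCocycles (M.shift n).gr (M.shift n).d (i - n),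
        Hom.lin f m ∈ dgCoboundaries (N.shift n).gr (N.shift n).d (i - n) →
          m ∈ dgCoboundaries (M.shift n).gr (M.shift n).d (i - n)) ∧
        ∀ y ∈ dgCocycles (N.shift n).gr (N.shift n).d (i - n),
          ∃ m ∈ dgCocycles (M.shift n).gr (M.shift n).d (i - n),
            (show N.carrier from y) - Hom.lin f m ∈ dgCoboundaries (N.shift n).gr (N.shift n).d (i - n) at this
      rwa [cocycles_shift, cocycles_shift, coboundaries_shift, coboundaries_shift,
        sub_add_cancel] at this
    · intro h i
      change (∀ m ∈ dgCocycles (M.shift n).gr (M.shift n).d i,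
        Hom.lin f m ∈ dgCoboundaries (N.shift n).gr (N.shift n).d i →
          m ∈ dgCoboundaries (M.shift n).gr (M.shift n).d i) ∧
        ∀ y ∈ dgCocycles (N.shift n).gr (N.shift n).d i,
          ∃ m ∈ dgCocycles (M.shift n).gr (M.shift n).d i,
            (show N.carrier from y) - Hom.lin f m ∈ dgCoboundaries (N.shift n).gr (N.shift n).d i
      rw [cocycles_shift, cocycles_shift, coboundaries_shift, coboundaries_shift]
      exact h (i + n)

/-! ### Mapping cones -/

/-- The mapping cone of `f : M ⟶ N`: the graded module `N ⊕ M[1]` with the differential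
`(n, m) ↦ (d n + f m, - d m)`. -/
def cone {M N : DGModule A} (f : M ⟶ N) : DGModule A where
  carrier := N.carrier × M.carrier
  gr i := (N.gr i).prod (M.gr (i + 1))
  isInternal := isInternal_prod N.isInternal (isInternal_shift M.isInternal 1)
  smul_mem {i j m a} hm ha := ⟨N.smul_mem hm.1 ha, by
    have := M.smul_mem hm.2 ha
    rwa [add_right_comm] at this⟩
  d := (N.d.coprod ((Hom.lin f).restrictScalars k)).prod (-(M.d ∘ₗ LinearMap.snd k _ _))
  d_mem {i m} hm := ⟨(N.gr _).add_mem (N.d_mem hm.1) (Hom.mem f hm.2),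
    (M.gr _).neg_mem (M.d_mem hm.2)⟩
  d_d m := by
    change (N.d (N.d m.1 + Hom.lin f m.2) + Hom.lin f (-M.d m.2), -M.d (-M.d m.2)) = 0
    simp [N.d_d, M.d_d, Hom.comm]
  leibniz {i m} hm a := by
    refine Prod.ext ?_ ?_
    · change N.d (m.1 <• a) + Hom.lin f (m.2 <• a) =
        (N.d m.1 + Hom.lin f m.2) <• a + Int.negOnePow i • (m.1 <• A.d a)
      rw [N.leibniz hm.1, map_smul, smul_add]
      abel
    · change -M.d (m.2 <• a) = (-M.d m.2) <• a + Int.negOnePow i • (m.2 <• A.d a)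
      rw [M.leibniz hm.2, Int.negOnePow_succ]
      simp [add_comm]

/-- The inclusion `N ⟶ cone f`. -/
def coneInl {M N : DGModule A} (f : M ⟶ N) : N ⟶ cone f :=
  Hom.mk (N := cone f) (LinearMap.inl _ N.carrier M.carrier)
    (fun i _ hn => ⟨hn, (M.gr (i + 1)).zero_mem⟩)
    (fun n => by
      change (N.d n, (0 : M.carrier)) = (N.d n + Hom.lin f 0, -M.d 0)
      simp)

/-- The projection `cone f ⟶ M[1]`. -/
def coneSnd {M N : DGModule A} (f : M ⟶ N) : cone f ⟶ M⟦(1 : ℤ)⟧ :=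
  Hom.mk (M := cone f) (N := M.shift 1) (LinearMap.snd _ N.carrier M.carrier)
    (fun _ _ hn => hn.2)
    (fun n => by
      change -M.d n.2 = Int.negOnePow 1 • M.d n.2
      simp)

/-- The triangle `M ⟶ N ⟶ cone f ⟶ M[1]` in `C(A)`. -/
def coneTriangle {M N : DGModule A} (f : M ⟶ N) : Triangle (DGModule A) :=
  Triangle.mk f (coneInl f) (coneSnd f)

end Category

end DGModule

/-! ### The additive structure of a localization -/

namespace LocalizationAdditive

variable {C : Type*} [Category C] [Preadditive C] [HasFiniteProducts C] [HasBinaryBiproducts C]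
  {W : MorphismProperty C} [W.ContainsIdentities] [W.IsStableUnderFiniteProducts]

/-- The image of a direct sum in the localization is a product. -/
def isLimitQ (M N : C) : IsLimit (BinaryFan.mk (W.Q.map (biprod.fst : M ⊞ N ⟶ M))
    (W.Q.map (biprod.snd : M ⊞ N ⟶ N))) :=
  mapIsLimitOfPreservesOfIsLimit W.Q _ _ (BinaryBiproduct.isLimit M N)

/-- The morphism to a direct sum with given components. -/
def pair {X : W.Localization} {M N : C} (f : X ⟶ W.Q.obj M) (g : X ⟶ W.Q.obj N) :
    X ⟶ W.Q.obj (M ⊞ N) :=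
  (isLimitQ M N).lift (BinaryFan.mk f g)

lemma pair_fst {X : W.Localization} {M N : C} (f : X ⟶ W.Q.obj M) (g : X ⟶ W.Q.obj N) :
    pair f g ≫ W.Q.map biprod.fst = f :=
  (isLimitQ M N).fac (BinaryFan.mk f g) ⟨WalkingPair.left⟩

lemma pair_snd {X : W.Localization} {M N : C} (f : X ⟶ W.Q.obj M) (g : X ⟶ W.Q.obj N) :
    pair f g ≫ W.Q.map biprod.snd = g :=
  (isLimitQ M N).fac (BinaryFan.mk f g) ⟨WalkingPair.right⟩

lemma pair_uniq {X : W.Localization} {M N : C} {s t : X ⟶ W.Q.obj (M ⊞ N)}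
    (h : s ≫ W.Q.map biprod.fst = t ≫ W.Q.map biprod.fst)
    (h' : s ≫ W.Q.map biprod.snd = t ≫ W.Q.map biprod.snd) : s = t :=
  BinaryFan.IsLimit.hom_ext (isLimitQ M N) h h'

/-- The sum of two morphisms. -/
def add {X : W.Localization} {M : C} (f g : X ⟶ W.Q.obj M) : X ⟶ W.Q.obj M :=
  pair f g ≫ W.Q.map (biprod.fst + biprod.snd)

lemma add_map {X : W.Localization} {L M : C} (t : X ⟶ W.Q.obj L) (a b : L ⟶ M) :
    add (t ≫ W.Q.map a) (t ≫ W.Q.map b) = t ≫ W.Q.map (a + b) := by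
  have : pair (t ≫ W.Q.map a) (t ≫ W.Q.map b) = t ≫ W.Q.map (biprod.lift a b) := by
    apply pair_uniq
    · rw [pair_fst, Category.assoc, ← W.Q.map_comp, biprod.lift_fst]
    · rw [pair_snd, Category.assoc, ← W.Q.map_comp, biprod.lift_snd]
  rw [add, this, Category.assoc, ← W.Q.map_comp]
  simp

lemma exists_pair {X : W.Localization} {M N : C} (f : X ⟶ W.Q.obj M) (g : X ⟶ W.Q.obj N) :
    ∃ (L : C) (t : X ⟶ W.Q.obj L) (a : L ⟶ M) (b : L ⟶ N),
      f = t ≫ W.Q.map a ∧ g = t ≫ W.Q.map b :=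
  ⟨M ⊞ N, pair f g, biprod.fst, biprod.snd, (pair_fst f g).symm, (pair_snd f g).symm⟩

lemma comp_add {X Y : W.Localization} {M : C} (h : Y ⟶ X) (f g : X ⟶ W.Q.obj M) :
    h ≫ add f g = add (h ≫ f) (h ≫ g) := by
  obtain ⟨L, t, a, b, rfl, rfl⟩ := exists_pair f g
  rw [add_map, ← Category.assoc, ← Category.assoc, ← Category.assoc, add_map]

/-- The sum of two morphisms, for an arbitrary target. -/
def add' {X Y : W.Localization} (f g : X ⟶ Y) : X ⟶ Y :=
  add (M := Y.as.obj) f g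

/-- The morphisms such that the composition with them respects sums. -/
def additiveMorphisms (W : MorphismProperty C) [W.ContainsIdentities]
    [W.IsStableUnderFiniteProducts] : MorphismProperty W.Localization := fun Y _ h =>
  ∀ (X : W.Localization) (f g : X ⟶ Y), add' f g ≫ h = add' (f ≫ h) (g ≫ h)

lemma additiveMorphisms_map {M N : C} (a : M ⟶ N) : additiveMorphisms W (W.Q.map a) := by
  intro X f g
  change add (M := M) f g ≫ W.Q.map a = add (M := N) (f ≫ W.Q.map a) (g ≫ W.Q.map a)
  obtain ⟨L, t, b, c, rfl, rfl⟩ := exists_pair f g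
  rw [add_map, Category.assoc, Category.assoc, Category.assoc, ← W.Q.map_comp, ← W.Q.map_comp,
    ← W.Q.map_comp, add_map, Preadditive.add_comp]

lemma additiveMorphisms_eq_top : additiveMorphisms W = ⊤ := by
  have : (additiveMorphisms W).IsStableUnderComposition :=
    ⟨fun a b ha hb X f g => by
      rw [← Category.assoc, ha, hb, Category.assoc, Category.assoc]⟩
  refine Localization.Construction.morphismProperty_eq_top _ (fun _ _ a => additiveMorphisms_map a)
    fun M N w hw X f g => ?_
  have h := additiveMorphisms_map (W := W) w X
    (f ≫ Localization.Construction.wInv w hw) (g ≫ Localization.Construction.wInv w hw)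
  have e : Localization.Construction.wInv w hw ≫ W.Q.map w = 𝟙 _ :=
    (Localization.Construction.wIso w hw).inv_hom_id
  have e' : W.Q.map w ≫ Localization.Construction.wInv w hw = 𝟙 _ :=
    (Localization.Construction.wIso w hw).hom_inv_id
  rw [Category.assoc, Category.assoc, e, Category.comp_id, Category.comp_id] at h
  rw [← h, Category.assoc, e', Category.comp_id]

/-- The zero morphism. -/
def zero (X : W.Localization) (M : C) : X ⟶ W.Q.obj M :=
  W.Q.map (0 : X.as.obj ⟶ M)

lemma comp_map_zero {X : W.Localization} {L : C} (t : X ⟶ W.Q.obj L) (M : C) :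
    t ≫ W.Q.map (0 : L ⟶ M) = zero X M := by
  have hT : IsTerminal (W.Q.obj (⊤_ C)) := IsTerminal.isTerminalObj W.Q _ terminalIsTerminal
  have h : ∀ K : C, (0 : K ⟶ M) = terminal.from K ≫ 0 := fun K => comp_zero.symm
  rw [zero, h L, h X.as.obj, W.Q.map_comp, W.Q.map_comp, ← Category.assoc]
  congr 1
  exact hT.hom_ext _ _

/-- The group structure on the morphisms. -/
abbrev homGroup (X : W.Localization) (M : C) : AddCommGroup (X ⟶ W.Q.obj M) :=
  letI : Zero (X ⟶ W.Q.obj M) := ⟨zero X M⟩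
  letI : Add (X ⟶ W.Q.obj M) := ⟨add⟩
  letI : Neg (X ⟶ W.Q.obj M) := ⟨fun f => f ≫ W.Q.map (-𝟙 M)⟩
  { AddGroup.ofLeftAxioms (G := X ⟶ W.Q.obj M)
      (fun f g h => by
        change add (add f g) h = add f (add g h)
        obtain ⟨L, t, a, b, rfl, rfl⟩ := exists_pair f g
        obtain ⟨L', t', a', c, rfl, rfl⟩ := exists_pair t h
        simp only [Category.assoc, ← W.Q.map_comp]
        rw [add_map, add_map, add_map, add_map, add_assoc])
      (fun f => by
        change add (zero X M) f = f
        have h := add_map f 0 (𝟙 M)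
        rwa [comp_map_zero, zero_add, W.Q.map_id, Category.comp_id] at h)
      (fun f => by
        change add (f ≫ W.Q.map (-𝟙 M)) f = zero X M
        have h := add_map f (-𝟙 M) (𝟙 M)
        rwa [neg_add_cancel, comp_map_zero, W.Q.map_id, Category.comp_id] at h) with
    add_comm := fun f g => by
      change add f g = add g f
      obtain ⟨L, t, a, b, rfl, rfl⟩ := exists_pair f g
      rw [add_map, add_map, add_comm] }

/-- The preadditive structure on the localization; the localization functor is additive. -/
abbrev preadditive (W : MorphismProperty C) [W.ContainsIdentities]
    [W.IsStableUnderFiniteProducts] : Preadditive W.Localization where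
  homGroup X Y := homGroup X Y.as.obj
  add_comp X Y Z f f' g := by
    have h : additiveMorphisms W g := by
      rw [additiveMorphisms_eq_top]
      trivial
    exact h X f f'
  comp_add X Y Z f g g' := comp_add (M := Z.as.obj) f g g'

lemma additive_Q : letI := preadditive W; W.Q.Additive :=
  letI := preadditive W
  { map_add := fun {M N f g} => by
      have h := add_map (𝟙 (W.Q.obj M)) f g
      rw [Category.id_comp, Category.id_comp, Category.id_comp] at h
      exact h.symm }

end LocalizationAdditive

/-! ### The derived category, perfect dg modules and dg modules with finite cohomology -/

namespace DGModule

section Derived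

variable {k : Type u} [CommRing k] (A : DGAlgebra.{u, v} k)

/-- The derived category `D(A)`, obtained from the category `C(A)` of dg `A`-modules by formally
inverting all quasi-isomorphisms. It carries the shift functors induced by those of `C(A)`, and
the `k`-linear structure for which the localization functor is `k`-linear. -/
abbrev Derived := (quasiIso A).Localization

/-- The localization functor `C(A) ⥤ D(A)`. -/
abbrev Q : DGModule A ⥤ Derived A := (quasiIso A).Q

instance : Preadditive (Derived A) := LocalizationAdditive.preadditive (quasiIso A)

instance : (Q A).Additive := LocalizationAdditive.additive_Q

variable {A}

/-- The distinguished triangles of `D(A)`: those which are isomorphic to the image of a mapping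
cone triangle `M ⟶ N ⟶ cone f ⟶ M[1]`. -/
def IsDistinguished (T : Triangle (Derived A)) : Prop :=
  ∃ (M N : DGModule A) (f : M ⟶ N), Nonempty (T ≅ (Q A).mapTriangle.obj (coneTriangle f))

/-- Strictly full triangulated subcategories of `D(A)` which are closed under direct summands,
as properties of objects. -/
structure IsThick (P : ObjectProperty (Derived A)) : Prop where
  isClosedUnderIsomorphisms : P.IsClosedUnderIsomorphisms
  containsZero : P.ContainsZero
  shift : ∀ X, P X → ∀ n : ℤ, P (X⟦n⟧)
  ext₁ : ∀ T : Triangle (Derived A), IsDistinguished T → P T.obj₂ → P T.obj₃ → P T.obj₁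
  ext₂ : ∀ T : Triangle (Derived A), IsDistinguished T → P T.obj₁ → P T.obj₃ → P T.obj₂
  ext₃ : ∀ T : Triangle (Derived A), IsDistinguished T → P T.obj₁ → P T.obj₂ → P T.obj₃
  summand : ∀ X Y : Derived A, Retract X Y → P Y → P X

/-- `thick(S)`: the smallest triangulated subcategory of `D(A)` which contains `S` and is closed
under direct summands. -/
def thick (S : ObjectProperty (Derived A)) : ObjectProperty (Derived A) :=
  fun X => ∀ P : ObjectProperty (Derived A), IsThick P → S ≤ P → P X

variable (A)

/-- `per(A) = thick(A_A)`. -/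
def per : ObjectProperty (Derived A) :=
  thick (fun X => X = (Q A).obj (regular A))

/-- `D_fd(A)`: the dg modules whose total cohomology is finitely generated over `k`
(finite-dimensional if `k` is a field). -/
def Dfd : ObjectProperty (Derived A) :=
  ObjectProperty.map (fun M : DGModule A => Module.Finite k (dgTotalCohomology M.d)) (Q A)

end Derived

end DGModule

end

/-!
Write `H^i` for the cohomology of `A`. Let `m` be such that `H^i` is finite-dimensional for `i > m`;
the point is that `H^m` is finite-dimensional, so that descending induction applies. As `A` lives
in nonpositive degrees, the truncation `X = τ^{≤ m} A` is a dg submodule of `A`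
(`exists_truncation`), and the cone of `X ⟶ A`, which computes `τ^{> m} A`, has finite-dimensional
total cohomology (`finite_dgTotalCohomology_cone`). By hypothesis the cone is perfect, hence so
is `X`, and `H^m(X) = H^m(A)` is the top cohomology of a perfect dg module.

The top cohomology of a perfect dg module `X` which vanishes above degree `m` is always
finite-dimensional (`finite_cohomology_of_per`): let `Y` be the `k`-dual of the left module `H^0(A)`,
as a right dg module concentrated in degree `m`. A functional `η` on `H^m(X)` gives the morphism
`x ↦ (a ↦ η (x a))` from `X` to `Y`, and `η` is recovered from its effect on `H^m` by evaluation at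
`a = 1`. So the dual of `H^m(X)` embeds into `Hom_{D(A)}(X, Y)`, which is finite-dimensional
because `X` is perfect and `Y` has finite-dimensional cohomology.

The last fact, and the Hom-finiteness of `per A`, come from `per_le_homFinite`: if `Z` has
finite-dimensional cohomology in each degree, then `Hom_{D(A)}(X, Z)` is finite-dimensional for all
perfect `X`. Such `X` form a thick subcategory because `Hom_{D(A)}(-, Z)` is exact in the middle of
a cone triangle (`exists_comp_eq_of_comp_eq_zero`), and it contains `A` because every morphism
`A ⟶ M` in `D(A)` is given by a cocycle of `M` (`exists_ofCocycle`). Both statements are proved by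
writing morphisms of `D(A)` as left fractions in the homotopy category `K(A)`, of which `D(A)` is
the localization.
-/

noncomputable section

namespace DGModule

section Homotopy

variable {k : Type u} [CommRing k] {A : DGAlgebra.{u, v} k}

/-! ### Quasi-isomorphisms in terms of elements -/

lemma quasiIso.exists_of_map_eq {M N : DGModule A} {f : M ⟶ N} (hf : quasiIso A f) {i j : ℤ}
    (hij : j + 1 = i) {m : M.carrier} (hm : m ∈ M.gr i) (hdm : M.d m = 0) {n : N.carrier}
    (hn : n ∈ N.gr j) (h : Hom.lin f m = N.d n) : ∃ x ∈ M.gr j, M.d x = m := by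
  obtain rfl : j = i - 1 := by lia
  exact ((quasiIso_iff f).1 hf i).1 m ⟨hm, hdm⟩ ⟨n, hn, h.symm⟩

lemma quasiIso.exists_lift {M N : DGModule A} {f : M ⟶ N} (hf : quasiIso A f) {i j : ℤ}
    (hij : j + 1 = i) {n : N.carrier} (hn : n ∈ N.gr i) (hdn : N.d n = 0) :
    ∃ m ∈ M.gr i, M.d m = 0 ∧ ∃ x ∈ N.gr j, n = Hom.lin f m + N.d x := by
  obtain rfl : j = i - 1 := by lia
  obtain ⟨m, ⟨hm, hdm⟩, x, hx, hx'⟩ := ((quasiIso_iff f).1 hf i).2 n ⟨hn, hdn⟩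
  exact ⟨m, hm, hdm, x, hx, by rw [hx']; abel⟩

lemma quasiIso.of_exists {M N : DGModule A} {f : M ⟶ N}
    (inj : ∀ (i j : ℤ), j + 1 = i → ∀ m ∈ M.gr i, M.d m = 0 → ∀ n ∈ N.gr j,
      Hom.lin f m = N.d n → ∃ x ∈ M.gr j, M.d x = m)
    (surj : ∀ (i j : ℤ), j + 1 = i → ∀ n ∈ N.gr i, N.d n = 0 →
      ∃ m ∈ M.gr i, M.d m = 0 ∧ ∃ x ∈ N.gr j, n = Hom.lin f m + N.d x) : quasiIso A f := by
  refine (quasiIso_iff f).2 fun i => ⟨?_, ?_⟩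
  · rintro m ⟨hm, hdm⟩ ⟨n, hn, h⟩
    exact inj i (i - 1) (by lia) m hm hdm n hn h.symm
  · rintro n ⟨hn, hdn⟩
    obtain ⟨m, hm, hdm, x, hx, e⟩ := surj i (i - 1) (by lia) n hn hdn
    exact ⟨m, ⟨hm, hdm⟩, x, hx, by rw [e]; abel⟩

/-- A dg module is acyclic when every homogeneous cocycle is a coboundary. -/
def Acyclic (M : DGModule A) : Prop :=
  ∀ i j : ℤ, j + 1 = i → ∀ m ∈ M.gr i, M.d m = 0 → ∃ x ∈ M.gr j, M.d x = m

lemma mem_cone_gr {M N : DGModule A} (f : M ⟶ N) {i j : ℤ} (hij : i + 1 = j) {n : N.carrier}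
    {m : M.carrier} : ((n, m) : (cone f).carrier) ∈ (cone f).gr i ↔ n ∈ N.gr i ∧ m ∈ M.gr j := by
  subst hij; rfl

/-- The cone of a quasi-isomorphism is acyclic. -/
lemma acyclic_cone {M N : DGModule A} {f : M ⟶ N} (hf : quasiIso A f) : (cone f).Acyclic := by
  rintro i j hij ⟨n, m⟩ hnm hd
  replace hnm := (mem_cone_gr f rfl).1 hnm
  have h1 : N.d n + Hom.lin f m = 0 := congrArg Prod.fst hd
  have h2 : M.d m = 0 := neg_eq_zero.1 (congrArg Prod.snd hd)
  obtain ⟨x, hx, rfl⟩ := hf.exists_of_map_eq rfl hnm.2 h2 (N.gr i |>.neg_mem hnm.1)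
    (by rw [map_neg]; exact (neg_eq_of_add_eq_zero_right h1).symm)
  obtain ⟨z, hz, hdz, y, hy, e⟩ := hf.exists_lift hij (N.gr i |>.add_mem hnm.1 (Hom.mem f hx))
    (by rw [map_add, ← Hom.comm, h1])
  refine ⟨(y, z - x), (mem_cone_gr f hij).2 ⟨hy, (M.gr i).sub_mem hz hx⟩, ?_⟩
  refine Prod.ext ?_ ?_
  · change N.d y + Hom.lin f (z - x) = n
    rw [map_sub, eq_sub_of_add_eq e]
    abel
  · change -M.d (z - x) = M.d x
    rw [map_sub, hdz]
    abel

/-- Coning off an acyclic dg module is a quasi-isomorphism. -/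
lemma quasiIso_coneInl {M N : DGModule A} (f : M ⟶ N) (hM : M.Acyclic) :
    quasiIso A (coneInl f) := by
  refine quasiIso.of_exists ?_ ?_
  · rintro i j hij n hn hdn ⟨y, m⟩ hm h
    replace hm := (mem_cone_gr f hij).1 hm
    have h1 : n = N.d y + Hom.lin f m := congrArg Prod.fst h
    have h2 : M.d m = 0 := neg_eq_zero.1 (congrArg Prod.snd h).symm
    obtain ⟨x, hx, rfl⟩ := hM i j hij m hm.2 h2
    exact ⟨y + Hom.lin f x, (N.gr j).add_mem hm.1 (Hom.mem f hx), by rw [map_add, ← Hom.comm, h1]⟩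
  · rintro i j hij ⟨y, m⟩ hm hd
    replace hm := (mem_cone_gr f rfl).1 hm
    have h1 : N.d y + Hom.lin f m = 0 := congrArg Prod.fst hd
    have h2 : M.d m = 0 := neg_eq_zero.1 (congrArg Prod.snd hd)
    obtain ⟨x, hx, rfl⟩ := hM (i + 1) i rfl m hm.2 h2
    refine ⟨y + Hom.lin f x, (N.gr i).add_mem hm.1 (Hom.mem f hx), by rw [map_add, ← Hom.comm, h1],
      ((0 : N.carrier), -x), (mem_cone_gr f hij).2 ⟨(N.gr j).zero_mem, (M.gr i).neg_mem hx⟩, ?_⟩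
    refine Prod.ext ?_ ?_
    · change y = y + Hom.lin f x + (N.d 0 + Hom.lin f (-x))
      rw [map_neg, map_zero]
      abel
    · change M.d x = 0 + -M.d (-x)
      rw [map_neg]
      abel

/-! ### Homotopies -/

/-- Two morphisms of dg modules are homotopic if their difference is `d ∘ h + h ∘ d` for some right
`A`-linear map `h` of degree `-1`. With the action on the right, no sign enters the linearity
of `h`. -/
def Homotopic : HomRel (DGModule A) := fun M N f g =>
  ∃ h : M.carrier →ₗ[(A.carrier)ᵐᵒᵖ] N.carrier, (∀ i j, j + 1 = i → ∀ m ∈ M.gr i, h m ∈ N.gr j) ∧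
    ∀ m, Hom.lin f m = Hom.lin g m + (N.d (h m) + h (M.d m))

instance : Congruence (Homotopic (A := A)) where
  comp_left {X Y Z} f {g g'} := by
    rintro ⟨h, hd, e⟩
    refine ⟨h ∘ₗ Hom.lin f, fun i j hij m hm => hd i j hij _ (Hom.mem f hm), fun m => ?_⟩
    rw [lin_comp, lin_comp, e, LinearMap.comp_apply, LinearMap.comp_apply, Hom.comm]
  comp_right {X Y Z} {f f'} g := by
    rintro ⟨h, hd, e⟩
    refine ⟨Hom.lin g ∘ₗ h, fun i j hij m hm => Hom.mem g (hd i j hij _ hm), fun m => ?_⟩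
    rw [lin_comp, lin_comp, e, LinearMap.comp_apply, LinearMap.comp_apply, map_add, map_add,
      Hom.comm]
  equivalence {X Y} :=
    { refl := fun f => ⟨0, fun _ j _ _ _ => (Y.gr j).zero_mem, fun m => by simp⟩
      symm := by
        rintro f g ⟨h, hd, e⟩
        refine ⟨-h, fun i j hij m hm => (Y.gr j).neg_mem (hd i j hij m hm), fun m => ?_⟩
        rw [e, LinearMap.neg_apply, LinearMap.neg_apply, map_neg]
        abel
      trans := by
        rintro f g l ⟨h, hd, e⟩ ⟨h', hd', e'⟩
        refine ⟨h + h', fun i j hij m hm => (Y.gr j).add_mem (hd i j hij m hm) (hd' i j hij m hm),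
          fun m => ?_⟩
        rw [e, e', LinearMap.add_apply, LinearMap.add_apply, map_add]
        abel }

/-- The morphism `cone f ⟶ L` given by `g : N ⟶ L` and a null-homotopy of `f ≫ g`. -/
def coneDesc {M N L : DGModule A} (f : M ⟶ N) (g : N ⟶ L)
    (h : M.carrier →ₗ[(A.carrier)ᵐᵒᵖ] L.carrier)
    (hd : ∀ i j, j + 1 = i → ∀ m ∈ M.gr i, h m ∈ L.gr j)
    (e : ∀ m, Hom.lin (f ≫ g) m = L.d (h m) + h (M.d m)) : cone f ⟶ L :=
  Hom.mk (M := cone f) ((Hom.lin g).coprod h)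
    (fun i m hm => (L.gr i).add_mem (Hom.mem g hm.1) (hd _ i rfl _ hm.2))
    (fun m => by
      obtain ⟨n, m⟩ := m
      change Hom.lin g (N.d n + Hom.lin f m) + h (-M.d m) = L.d (Hom.lin g n + h m)
      rw [map_add, map_add, ← lin_comp, e, Hom.comm, map_neg]
      abel)

/-- A morphism `g` extends along `N ⟶ cone f` as soon as `f ≫ g` is null-homotopic. -/
lemma exists_coneInl_comp {M N L : DGModule A} {f : M ⟶ N} {g : N ⟶ L}
    (hfg : Homotopic (f ≫ g) 0) : ∃ h : cone f ⟶ L, coneInl f ≫ h = g := by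
  obtain ⟨h, hd, e⟩ := hfg
  refine ⟨coneDesc f g h hd fun m => by rw [e, lin_zero, zero_add], hom_ext fun n => ?_⟩
  change Hom.lin g n + h 0 = Hom.lin g n
  rw [map_zero, add_zero]

lemma homotopic_comp_coneInl {M N : DGModule A} (f : M ⟶ N) : Homotopic (f ≫ coneInl f) 0 := by
  refine ⟨LinearMap.inr _ N.carrier M.carrier,
    fun i j hij m hm => (mem_cone_gr f hij).2 ⟨(N.gr j).zero_mem, hm⟩, fun m => ?_⟩
  change (Hom.lin f m, (0 : M.carrier)) =
    0 + ((N.d 0 + Hom.lin f m, -M.d m) + ((0 : N.carrier), M.d m))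
  rw [map_zero]
  refine Prod.ext ?_ ?_ <;> simp

lemma homotopic_sub_iff {M N : DGModule A} {f g : M ⟶ N} :
    Homotopic (f - g) 0 ↔ Homotopic f g := by
  have hs : ∀ m, Hom.lin (f - g) m = Hom.lin f m - Hom.lin g m := fun _ => rfl
  constructor <;> rintro ⟨h, hd, e⟩ <;> refine ⟨h, hd, fun m => ?_⟩
  · have := e m
    rw [lin_zero, zero_add, hs] at this
    rw [← this]
    abel
  · rw [hs, e, lin_zero]
    abel

lemma quasiIso_id (M : DGModule A) : quasiIso A (𝟙 M) :=
  MorphismProperty.id_mem _ _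

/-- Homotopic morphisms become equal in `D(A)`: a null-homotopic morphism factors through the
acyclic cone of an identity. -/
lemma Q_map_eq_of_homotopic {M N : DGModule A} {f g : M ⟶ N} (h : Homotopic f g) :
    (Q A).map f = (Q A).map g := by
  rw [← sub_eq_zero, ← Functor.map_sub]
  obtain ⟨t, ht⟩ := exists_coneInl_comp (f := 𝟙 M) (g := f - g) (by
    rw [Category.id_comp]
    exact homotopic_sub_iff.2 h)
  have hz : quasiIso A (0 : cone (𝟙 M) ⟶ zeroModule A) := by
    refine quasiIso.of_exists (fun i j hij m hm hdm _ _ _ => ?_) (fun i j _ n _ _ => ?_)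
    · exact acyclic_cone (quasiIso_id M) i j hij m hm hdm
    · exact ⟨0, Submodule.zero_mem _, map_zero _, 0, Submodule.zero_mem _,
        Subsingleton.elim (α := PUnit) _ _⟩
  have hi : IsIso ((Q A).map (0 : cone (𝟙 M) ⟶ zeroModule A)) := (quasiIso A).Q_inverts _ hz
  have ht' : (Q A).map t = 0 := by
    have : IsZero ((Q A).obj (zeroModule A)) := Functor.map_isZero _ isZero_zeroModule
    exact (this.of_iso (asIso ((Q A).map (0 : cone (𝟙 M) ⟶ zeroModule A)))).eq_of_src _ _
  rw [← ht, Functor.map_comp, ht', comp_zero]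

/-! ### The calculus of fractions in the homotopy category -/

variable (A) in
/-- The homotopy category `K(A)`. -/
abbrev HomotopyCat := CategoryTheory.Quotient (Homotopic (A := A))

variable (A) in
/-- The functor `C(A) ⥤ K(A)`. -/
abbrev toHomotopyCat : DGModule A ⥤ HomotopyCat A := CategoryTheory.Quotient.functor _

variable (A) in
/-- The functor `K(A) ⥤ D(A)`. -/
def homotopyCatToDerived : HomotopyCat A ⥤ Derived A :=
  CategoryTheory.Quotient.lift _ (Q A) fun _ _ _ _ h => Q_map_eq_of_homotopic h

variable (A) in
/-- The morphisms of `K(A)` which are represented by quasi-isomorphisms. -/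
def homotopyQuasiIso : MorphismProperty (HomotopyCat A) := fun X Y f =>
  ∃ s : X.as ⟶ Y.as, quasiIso A s ∧ (toHomotopyCat A).map s = f

lemma homotopyQuasiIso_map {M N : DGModule A} {s : M ⟶ N} (hs : quasiIso A s) :
    homotopyQuasiIso A ((toHomotopyCat A).map s) := ⟨s, hs, rfl⟩

variable (A) in
/-- `D(A)` is strictly the localization of `K(A)` at the quasi-isomorphisms, because homotopic
morphisms already agree in `D(A)`. -/
def homotopyCatUniversal (E : Type*) [Category E] :
    Localization.StrictUniversalPropertyFixedTarget (homotopyCatToDerived A)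
      (homotopyQuasiIso A) E where
  inverts := by
    rintro X Y _ ⟨s, hs, rfl⟩
    exact (quasiIso A).Q_inverts s hs
  lift F hF := Localization.Construction.lift (toHomotopyCat A ⋙ F)
    fun _ _ s hs => hF _ (homotopyQuasiIso_map hs)
  fac F hF := by
    refine CategoryTheory.Quotient.lift_unique' _ _ _ ?_
    exact Localization.Construction.fac (toHomotopyCat A ⋙ F)
      fun _ _ s hs => hF _ (homotopyQuasiIso_map hs)
  uniq F₁ F₂ h := by
    refine Localization.Construction.uniq _ _ ?_
    exact congrArg (toHomotopyCat A ⋙ ·) h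

instance : (homotopyCatToDerived A).IsLocalization (homotopyQuasiIso A) :=
  Functor.IsLocalization.mk' _ _ (homotopyCatUniversal A _) (homotopyCatUniversal A _)

instance : (homotopyQuasiIso A).IsMultiplicative where
  id_mem X := ⟨𝟙 _, quasiIso_id _, rfl⟩
  comp_mem := by
    rintro X Y Z _ _ ⟨s, hs, rfl⟩ ⟨t, ht, rfl⟩
    exact ⟨s ≫ t, MorphismProperty.comp_mem _ _ _ hs ht, rfl⟩

/-- A span `X' ← X → Y` whose left leg is a quasi-isomorphism is completed to a square in `K(A)` by
its homotopy pushout, the cone of `(s, -g) : X ⟶ X' ⊕ Y`. -/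
lemma exists_square {X X' Y : DGModule A} (s : X ⟶ X') (hs : quasiIso A s) (g : X ⟶ Y) :
    ∃ (Y' : DGModule A) (t : Y ⟶ Y') (g' : X' ⟶ Y'), quasiIso A t ∧
      Homotopic (g ≫ t) (s ≫ g') := by
  let p : X ⟶ prodModule X' Y := Hom.mk ((Hom.lin s).prod (-Hom.lin g))
    (fun i m hm => ⟨Hom.mem s hm, (Y.gr i).neg_mem (Hom.mem g hm)⟩)
    (fun m => Prod.ext (Hom.comm s m) (by
      change -Hom.lin g (X.d m) = Y.d (-Hom.lin g m)
      rw [map_neg, Hom.comm]))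
  refine ⟨cone p, (prodBicone X' Y).inr ≫ coneInl p, (prodBicone X' Y).inl ≫ coneInl p, ?_, ?_⟩
  · refine quasiIso.of_exists ?_ ?_
    · rintro i j hij y hy hdy ⟨⟨x', y₀⟩, x⟩ hm h
      replace hm := (mem_cone_gr p hij).1 hm
      have h1 : 0 = X'.d x' + Hom.lin s x := congrArg (fun z => z.1.1) h
      have h2 : y = Y.d y₀ + -Hom.lin g x := congrArg (fun z => z.1.2) h
      have h3 : X.d x = 0 := neg_eq_zero.1 (congrArg (fun z => z.2) h).symm
      obtain ⟨x₀, hx₀, rfl⟩ := hs.exists_of_map_eq hij hm.2 h3 ((X'.gr j).neg_mem hm.1.1)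
        (by rw [map_neg]; exact (neg_eq_of_add_eq_zero_right h1.symm).symm)
      exact ⟨y₀ - Hom.lin g x₀, (Y.gr j).sub_mem hm.1.2 (Hom.mem g hx₀), by
        rw [map_sub, ← Hom.comm, h2, sub_eq_add_neg]⟩
    · rintro i j hij ⟨⟨x', y⟩, x⟩ hm hd
      replace hm := (mem_cone_gr p rfl).1 hm
      have h1 : X'.d x' + Hom.lin s x = 0 := congrArg (fun z => z.1.1) hd
      have h2 : Y.d y + -Hom.lin g x = 0 := congrArg (fun z => z.1.2) hd
      have h3 : X.d x = 0 := neg_eq_zero.1 (congrArg (fun z => z.2) hd)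
      obtain ⟨x₀, hx₀, rfl⟩ := hs.exists_of_map_eq rfl hm.2 h3 ((X'.gr i).neg_mem hm.1.1)
        (by rw [map_neg]; exact (neg_eq_of_add_eq_zero_right h1).symm)
      obtain ⟨z, hz, hdz, w, hw, e⟩ := hs.exists_lift hij
        ((X'.gr i).add_mem hm.1.1 (Hom.mem s hx₀)) (by rw [map_add, ← Hom.comm, h1])
      refine ⟨y - Hom.lin g (x₀ - z), (Y.gr i).sub_mem hm.1.2 (Hom.mem g ((X.gr i).sub_mem hx₀ hz)),
        by rw [map_sub, ← Hom.comm, map_sub, hdz, sub_zero, sub_eq_add_neg, h2],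
        ((w, (0 : Y.carrier)), z - x₀), (mem_cone_gr p hij).2
          ⟨⟨hw, (Y.gr j).zero_mem⟩, (X.gr i).sub_mem hz hx₀⟩, ?_⟩
      refine Prod.ext (Prod.ext ?_ ?_) ?_
      · change x' = 0 + (X'.d w + Hom.lin s (z - x₀))
        rw [map_sub, show x' = _ from eq_sub_of_add_eq e]
        abel
      · change y = y - Hom.lin g (x₀ - z) + (Y.d 0 + -Hom.lin g (z - x₀))
        rw [map_sub, map_sub, map_zero]
        abel
      · change X.d x₀ = 0 + -X.d (z - x₀)
        rw [map_sub, hdz]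
        abel
  · refine ⟨-LinearMap.inr _ (prodModule X' Y).carrier X.carrier, fun i j hij m hm =>
      (cone p |>.gr j).neg_mem ((mem_cone_gr p hij).2 ⟨Submodule.zero_mem _, hm⟩), fun m => ?_⟩
    refine Prod.ext (Prod.ext ?_ ?_) ?_
    · change 0 = Hom.lin s m + ((X'.d (-0) + Hom.lin s (-m)) + -0)
      simp
    · change Hom.lin g m = 0 + ((Y.d (-0) + -Hom.lin g (-m)) + -0)
      simp
    · change 0 = 0 + (-X.d (-m) + -X.d m)
      simp

/-- If `g` vanishes in `K(A)` after composition with a quasi-isomorphism `s`, it factors through the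
acyclic cone of `s`, and coning off this factorization kills `g`. -/
lemma exists_coequalizing {X X' Y : DGModule A} (s : X ⟶ X') (hs : quasiIso A s) (g : X' ⟶ Y)
    (h : Homotopic (s ≫ g) 0) : ∃ (Y' : DGModule A) (t : Y ⟶ Y'), quasiIso A t ∧
      Homotopic (g ≫ t) 0 := by
  obtain ⟨l, hl⟩ := exists_coneInl_comp h
  refine ⟨cone l, coneInl l, quasiIso_coneInl l (acyclic_cone hs), ?_⟩
  have := HomRel.comp_left (r := Homotopic) (coneInl s) (homotopic_comp_coneInl l)
  rwa [← Category.assoc, hl, comp_zero] at this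

instance : (homotopyQuasiIso A).HasLeftCalculusOfFractions where
  exists_leftFraction := by
    rintro ⟨X⟩ ⟨Y⟩ ⟨_, ⟨s, hs, rfl⟩, f⟩
    obtain ⟨f, rfl⟩ := (toHomotopyCat A).map_surjective f
    obtain ⟨Y', t, g', ht, h⟩ := exists_square s hs f
    exact ⟨⟨(toHomotopyCat A).map g', _, homotopyQuasiIso_map ht⟩,
      CategoryTheory.Quotient.sound _ h⟩
  ext := by
    rintro ⟨X'⟩ ⟨X⟩ ⟨Y⟩ f₁ f₂ _ ⟨s, hs, rfl⟩ h
    obtain ⟨f₁, rfl⟩ := (toHomotopyCat A).map_surjective f₁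
    obtain ⟨f₂, rfl⟩ := (toHomotopyCat A).map_surjective f₂
    have h' : Homotopic (s ≫ f₁) (s ≫ f₂) :=
      (CategoryTheory.Quotient.functor_map_eq_iff _ _ _).1 h
    rw [← homotopic_sub_iff, ← Preadditive.comp_sub] at h'
    obtain ⟨Y', t, ht, e⟩ := exists_coequalizing s hs (f₁ - f₂) h'
    rw [Preadditive.sub_comp, homotopic_sub_iff] at e
    exact ⟨_, _, homotopyQuasiIso_map ht, CategoryTheory.Quotient.sound _ e⟩

/-! ### Morphisms in the derived category -/

/-- Every morphism of `D(A)` is a left fraction. -/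
lemma exists_fraction {M N : DGModule A} (g : (Q A).obj M ⟶ (Q A).obj N) :
    ∃ (L : DGModule A) (g' : M ⟶ L) (s : N ⟶ L), quasiIso A s ∧
      g ≫ (Q A).map s = (Q A).map g' := by
  obtain ⟨⟨g', _, ⟨s, hs, rfl⟩⟩, e⟩ := Localization.exists_leftFraction (homotopyCatToDerived A)
    (homotopyQuasiIso A) (X := (toHomotopyCat A).obj M) (Y := (toHomotopyCat A).obj N) g
  obtain ⟨g', rfl⟩ := (toHomotopyCat A).map_surjective g'
  refine ⟨_, g', s, hs, ?_⟩
  rw [e]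
  exact MorphismProperty.LeftFraction.map_comp_map_s _ _ _

/-- Equality in `D(A)` means homotopy after composition with a quasi-isomorphism. -/
lemma exists_homotopic_comp {M N : DGModule A} {f g : M ⟶ N} (h : (Q A).map f = (Q A).map g) :
    ∃ (L : DGModule A) (s : N ⟶ L), quasiIso A s ∧ Homotopic (f ≫ s) (g ≫ s) := by
  obtain ⟨_, _, ⟨s, hs, rfl⟩, e⟩ := (MorphismProperty.map_eq_iff_postcomp (homotopyCatToDerived A)
    (homotopyQuasiIso A) ((toHomotopyCat A).map f) ((toHomotopyCat A).map g)).1 h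
  exact ⟨_, s, hs, (CategoryTheory.Quotient.functor_map_eq_iff _ _ _).1 e⟩

/-- `Hom(-, Z)` is exact in the middle of the image of `M ⟶ N ⟶ cone f`. -/
lemma exists_comp_eq_of_comp_eq_zero {M N : DGModule A} (f : M ⟶ N) {Z : Derived A}
    (g : (Q A).obj N ⟶ Z) (h : (Q A).map f ≫ g = 0) :
    ∃ g' : (Q A).obj (cone f) ⟶ Z, (Q A).map (coneInl f) ≫ g' = g := by
  obtain ⟨P, rfl⟩ : ∃ P, Z = (Q A).obj P := ⟨Z.as.obj, rfl⟩
  obtain ⟨L, g₁, s, hs, e⟩ := exists_fraction g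
  have h' : (Q A).map (f ≫ g₁) = (Q A).map 0 := by
    rw [Functor.map_comp, ← e, ← Category.assoc, h, zero_comp, Functor.map_zero]
  obtain ⟨L', t, ht, e'⟩ := exists_homotopic_comp h'
  rw [Category.assoc, zero_comp] at e'
  obtain ⟨l, hl⟩ := exists_coneInl_comp e'
  have hst : IsIso ((Q A).map (s ≫ t)) :=
    (quasiIso A).Q_inverts _ (MorphismProperty.comp_mem _ _ _ hs ht)
  refine ⟨(Q A).map l ≫ inv ((Q A).map (s ≫ t)), ?_⟩
  rw [← Category.assoc, ← Functor.map_comp, hl, IsIso.comp_inv_eq, Functor.map_comp,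
    Functor.map_comp, ← Category.assoc, ← e, Category.assoc]

/-- The right `A`-linear map `a ↦ x a`. -/
def smulLin (M : DGModule A) (x : M.carrier) : A.carrier →ₗ[(A.carrier)ᵐᵒᵖ] M.carrier where
  toFun a := x <• a
  map_add' a b := by rw [MulOpposite.op_add, add_smul]
  map_smul' c a := by
    change MulOpposite.op (a * c.unop) • x = c • MulOpposite.op a • x
    rw [smul_smul]
    rfl

/-- The morphism `A ⟶ M` of dg modules given by a cocycle of degree zero. -/
def ofCocycle (M : DGModule A) : dgCocycles M.gr M.d 0 →ₗ[k] (regular A ⟶ M) where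
  toFun x := Hom.mk (M := regular A) (smulLin M x.1)
    (fun i a ha => by
      have := M.smul_mem x.2.1 ha
      rwa [zero_add] at this)
    (fun (a : A.carrier) => by
      have hx : M.d x.1 = 0 := x.2.2
      change x.1 <• A.d a = M.d (x.1 <• a)
      rw [M.leibniz x.2.1, hx]
      simp)
  map_add' x y := hom_ext fun a => smul_add (MulOpposite.op (show A.carrier from a)) x.1 y.1
  map_smul' c x := hom_ext fun a =>
    smul_comm (MulOpposite.op (show A.carrier from a)) c x.1

/-- If `x = d y`, then `a ↦ y a` is a null-homotopy of `a ↦ x a`. -/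
lemma homotopic_ofCocycle_zero (M : DGModule A) (x : dgCocycles M.gr M.d 0)
    (hx : x.1 ∈ dgCoboundaries M.gr M.d 0) : Homotopic (ofCocycle M x) 0 := by
  obtain ⟨y, hy, e⟩ := hx
  refine ⟨smulLin M y, fun i j hij a ha => ?_, fun a => ?_⟩
  · have := M.smul_mem hy ha
    rwa [show (0 : ℤ) - 1 + i = j by lia] at this
  · change x.1 <• (show A.carrier from a) =
      0 + (M.d (y <• (show A.carrier from a)) + y <• A.d a)
    rw [M.leibniz hy, e]
    simp

lemma Q_map_ofCocycle_eq (M : DGModule A) (x y : dgCocycles M.gr M.d 0)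
    (hxy : x.1 - y.1 ∈ dgCoboundaries M.gr M.d 0) :
    (Q A).map (ofCocycle M x) = (Q A).map (ofCocycle M y) := by
  have := Q_map_eq_of_homotopic (homotopic_ofCocycle_zero M (x - y) hxy)
  rwa [map_sub, Functor.map_sub, Functor.map_zero, sub_eq_zero] at this

/-- Every morphism `A ⟶ M` in `D(A)` is given by a cocycle of `M`. -/
lemma exists_ofCocycle {M : DGModule A} (g : (Q A).obj (regular A) ⟶ (Q A).obj M) :
    ∃ x, (Q A).map (ofCocycle M x) = g := by
  obtain ⟨L, g', s, hs, e⟩ := exists_fraction g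
  have h1 : A.d 1 = 0 := by
    have := A.leibniz A.one_mem 1
    simpa using this
  have hy : Hom.lin g' (1 : A.carrier) ∈ dgCocycles L.gr L.d 0 :=
    Hom.mem_cocycles g' (M := regular A) ⟨A.one_mem, h1⟩
  have hg' : g' = ofCocycle L ⟨_, hy⟩ := hom_ext fun a : A.carrier => by
    refine Eq.trans ?_ ((Hom.lin g').map_smul (MulOpposite.op a) (1 : A.carrier))
    exact congrArg (Hom.lin g') (one_mul a).symm
  obtain ⟨x, hx, hx'⟩ := ((quasiIso_iff s).1 hs 0).2 _ hy
  refine ⟨⟨x, hx⟩, ?_⟩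
  have hi : IsIso ((Q A).map s) := (quasiIso A).Q_inverts _ hs
  rw [← cancel_mono ((Q A).map s), e, hg', ← Functor.map_comp,
    Q_map_ofCocycle_eq L ⟨_, hy⟩ ⟨_, Hom.mem_cocycles s hx⟩ hx']
  congr 1
  exact hom_ext fun a : A.carrier => (Hom.lin s).map_smul _ _

end Homotopy

section Finiteness

variable {k : Type u} [Field k] {A : DGAlgebra.{u, v} k}

/-! ### Morphisms from the free module -/

lemma finite_hom_regular (M : DGModule A) [h : Module.Finite k (M.cohomology 0)] :
    Module.Finite k ((Q A).obj (regular A) ⟶ (Q A).obj M) := by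
  let φ : M.cohomology 0 →ₗ[k] ((Q A).obj (regular A) ⟶ (Q A).obj M) :=
    Submodule.liftQ _ ((Functor.mapLinearMap k (Q A)).comp (ofCocycle M)) fun x hx => by
      have := Q_map_ofCocycle_eq M x 0 (by rw [ZeroMemClass.coe_zero, sub_zero]; exact hx)
      rwa [map_zero, Functor.map_zero] at this
  refine Module.Finite.of_surjective φ fun g => ?_
  obtain ⟨x, rfl⟩ := exists_ofCocycle g
  exact ⟨Submodule.Quotient.mk x, rfl⟩

end Finiteness

section Thick

variable {k : Type u} [CommRing k] {A : DGAlgebra.{u, v} k}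

/-! ### Thick subcategories -/

/-- The projection from the cone of `N ⟶ cone f` to `M[1]`. -/
def coneInlSnd {M N : DGModule A} (f : M ⟶ N) : cone (coneInl f) ⟶ M⟦(1 : ℤ)⟧ :=
  coneDesc (coneInl f) (coneSnd f) 0 (fun _ j _ _ _ => Submodule.zero_mem (M.gr (j + 1)))
    (fun n => by
      change (0 : M.carrier) = Int.negOnePow 1 • M.d 0 + 0
      simp)

/-- The rotation of the cone triangle of `f` is isomorphic to the cone triangle of `N ⟶ cone f`. -/
lemma quasiIso_coneInlSnd {M N : DGModule A} (f : M ⟶ N) : quasiIso A (coneInlSnd f) := by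
  have happ : ∀ (n n' : N.carrier) (m : M.carrier),
      Hom.lin (coneInlSnd f) ((n, m), n') = m := fun n n' m => add_zero (M := M.carrier) m
  have hd' : ∀ m : M.carrier, (M⟦(1 : ℤ)⟧ : DGModule A).d m = -M.d m := fun m => by
    change Int.negOnePow 1 • M.d m = -M.d m
    simp
  refine quasiIso.of_exists ?_ ?_
  · rintro i j hij ⟨⟨n, m⟩, n'⟩ hm hd (x : M.carrier) hx h
    replace hm := (mem_cone_gr _ rfl).1 hm
    have h0 : n ∈ N.gr i ∧ m ∈ M.gr (i + 1) := hm.1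
    have h1 : N.d n + Hom.lin f m + n' = 0 := congrArg (fun z => z.1.1) hd
    have hmx : m = -M.d x := (happ n n' m).symm.trans (h.trans (hd' x))
    replace hx : x ∈ M.gr (j + 1) := hx
    refine ⟨((0, x), n - Hom.lin f x), (mem_cone_gr _ hij).2 ⟨⟨Submodule.zero_mem _, hx⟩, ?_⟩, ?_⟩
    · rw [hij] at hx
      exact (N.gr i).sub_mem h0.1 (Hom.mem f hx)
    · refine Prod.ext (Prod.ext ?_ ?_) ?_
      · change N.d 0 + Hom.lin f x + (n - Hom.lin f x) = n
        rw [map_zero]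
        abel
      · change -M.d x + 0 = m
        rw [hmx, add_zero]
      · change -N.d (n - Hom.lin f x) = n'
        rw [map_sub, ← Hom.comm, eq_neg_of_add_eq_zero_right h1, hmx, map_neg]
        abel
  · rintro i j hij (m : M.carrier) hm hdm
    replace hm : m ∈ M.gr (i + 1) := hm
    have hdm' : M.d m = 0 := neg_eq_zero.1 ((hd' m).symm.trans hdm)
    refine ⟨((0, m), -Hom.lin f m), (mem_cone_gr _ rfl).2
      ⟨⟨Submodule.zero_mem _, hm⟩, Submodule.neg_mem _ (Hom.mem f hm)⟩, ?_,
      0, Submodule.zero_mem _, ?_⟩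
    · refine Prod.ext (Prod.ext ?_ ?_) ?_
      · change N.d 0 + Hom.lin f m + -Hom.lin f m = 0
        rw [map_zero]
        abel
      · change -M.d m + 0 = 0
        rw [hdm']
        simp
      · change -N.d (-Hom.lin f m) = 0
        rw [map_neg, ← Hom.comm, hdm']
        simp
    · rw [happ, map_zero]
      exact (add_zero m).symm

/-- For the two-out-of-three conditions of a thick subcategory it suffices to consider the middle
term of a cone triangle, by rotation. -/
lemma IsThick.of_middle {P : ObjectProperty (Derived A)}
    (retract : ∀ X Y : Derived A, Retract X Y → P Y → P X)
    (zero : P ((Q A).obj (zeroModule A))) (shift : ∀ X, P X → ∀ n : ℤ, P (X⟦n⟧))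
    (middle : ∀ {M N : DGModule A} (f : M ⟶ N), P ((Q A).obj M) → P ((Q A).obj (cone f)) →
      P ((Q A).obj N)) : IsThick P := by
  have iso : ∀ {X Y : Derived A}, (X ≅ Y) → P Y → P X := fun e =>
    retract _ _ ⟨e.hom, e.inv, e.hom_inv_id⟩
  have rot : ∀ {M N : DGModule A} (f : M ⟶ N), P ((Q A).obj (cone (coneInl f))) ↔
      P ((Q A).obj M) := fun {M N} f => by
    have : IsIso ((Q A).map (coneInlSnd f)) := (quasiIso A).Q_inverts _ (quasiIso_coneInlSnd f)
    have e : (Q A).obj (cone (coneInl f)) ≅ ((Q A).obj M)⟦(1 : ℤ)⟧ :=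
      asIso ((Q A).map (coneInlSnd f)) ≪≫ ((Q A).commShiftIso (1 : ℤ)).app M
    exact ⟨fun h => iso (shiftShiftNeg ((Q A).obj M) (1 : ℤ)).symm (shift _ (iso e.symm h) (-1)),
      fun h => iso e (shift _ h 1)⟩
  have last : ∀ {M N : DGModule A} (f : M ⟶ N), P ((Q A).obj M) → P ((Q A).obj N) →
      P ((Q A).obj (cone f)) := fun f hM hN => middle (coneInl f) hN ((rot f).2 hM)
  have first : ∀ {M N : DGModule A} (f : M ⟶ N), P ((Q A).obj N) → P ((Q A).obj (cone f)) →
      P ((Q A).obj M) := fun f hN hC => (rot f).1 (last (coneInl f) hN hC)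
  refine ⟨⟨fun e h => iso e.symm h⟩, ⟨⟨_, Functor.map_isZero _ isZero_zeroModule, zero⟩⟩, shift,
    ?_, ?_, ?_, retract⟩
  · rintro T ⟨M, N, f, ⟨e⟩⟩ h₂ h₃
    exact iso (Triangle.π₁.mapIso e) (first f (iso (Triangle.π₂.mapIso e).symm h₂)
      (iso (Triangle.π₃.mapIso e).symm h₃))
  · rintro T ⟨M, N, f, ⟨e⟩⟩ h₁ h₃
    exact iso (Triangle.π₂.mapIso e) (middle f (iso (Triangle.π₁.mapIso e).symm h₁)
      (iso (Triangle.π₃.mapIso e).symm h₃))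
  · rintro T ⟨M, N, f, ⟨e⟩⟩ h₁ h₂
    exact iso (Triangle.π₃.mapIso e) (last f (iso (Triangle.π₁.mapIso e).symm h₁)
      (iso (Triangle.π₂.mapIso e).symm h₂))

lemma isDistinguished_cone {M N : DGModule A} (f : M ⟶ N) :
    IsDistinguished ((Q A).mapTriangle.obj (coneTriangle f)) :=
  ⟨M, N, f, ⟨Iso.refl _⟩⟩

lemma per_le {P : ObjectProperty (Derived A)} (hP : IsThick P)
    (h : P ((Q A).obj (regular A))) : per A ≤ P :=
  fun _ hX => hX P hP (by rintro _ rfl; exact h)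

/-- `per A` inherits from the thick subcategories defining it the closure under the first term of a
cone triangle. -/
lemma per_source_of_cone {M N : DGModule A} (f : M ⟶ N) (hN : per A ((Q A).obj N))
    (hC : per A ((Q A).obj (cone f))) : per A ((Q A).obj M) :=
  fun P hP h => hP.ext₁ _ (isDistinguished_cone f) (hN P hP h) (hC P hP h)

lemma per_regular : per A ((Q A).obj (regular A)) :=
  fun _ _ h => h _ rfl

instance (n : ℤ) : (shiftFunctor (DGModule A) n).Additive := ⟨rfl⟩

instance (n : ℤ) : (shiftFunctor (DGModule A) n).Linear k := ⟨fun _ _ => rfl⟩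

instance (n : ℤ) : (shiftFunctor (Derived A) n).Additive where
  map_add {X Y f g} := by
    obtain ⟨N, rfl⟩ : ∃ N, Y = (Q A).obj N := ⟨Y.as.obj, rfl⟩
    obtain ⟨L, t, a, b, rfl, rfl⟩ := LocalizationAdditive.exists_pair f g
    have h : ∀ c : L ⟶ N, (shiftFunctor (Derived A) n).map ((Q A).map c) =
        ((Q A).commShiftIso n).inv.app L ≫ (Q A).map (c⟦n⟧') ≫
          ((Q A).commShiftIso n).hom.app N := fun c => by simp
    rw [← Preadditive.comp_add, ← Functor.map_add, Functor.map_comp, Functor.map_comp,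
      Functor.map_comp, h, h, h, Functor.map_add, Functor.map_add]
    simp only [Preadditive.comp_add, Preadditive.add_comp]

instance (n : ℤ) : (shiftFunctor (Derived A) n).Linear k :=
  Shift.linear_of_localization k (Q A) (quasiIso A) n

/-! ### Cohomology on the derived category -/

variable (A) in
/-- The functor `H^i` on `C(A)`. -/
def cohomologyFunctor (i : ℤ) : DGModule A ⥤ ModuleCat.{v} k where
  obj M := ModuleCat.of k (M.cohomology i)
  map f := ModuleCat.ofHom (cohomologyMap f i)
  map_id M := by rw [cohomologyMap_id]; rfl
  map_comp f g := by rw [cohomologyMap_comp]; rfl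

variable (A) in
/-- The functor `H^i` on `D(A)`. -/
def derivedCohomology (i : ℤ) : Derived A ⥤ ModuleCat.{v} k :=
  Localization.Construction.lift (cohomologyFunctor A i) fun _ _ f hf => by
    have : Function.Bijective (cohomologyFunctor A i |>.map f) := hf i
    exact (ConcreteCategory.isIso_iff_bijective _).2 this

lemma derivedCohomology_map {M N : DGModule A} (f : M ⟶ N) (i : ℤ) :
    (derivedCohomology A i).map ((Q A).map f) = ModuleCat.ofHom (cohomologyMap f i) :=
  Category.id_comp _

lemma cohomologyMap_eq_of_Q_map_eq {M N : DGModule A} {f g : M ⟶ N}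
    (h : (Q A).map f = (Q A).map g) (i : ℤ) : cohomologyMap f i = cohomologyMap g i := by
  have := congrArg (derivedCohomology A i).map h
  rw [derivedCohomology_map, derivedCohomology_map] at this
  exact congrArg ModuleCat.Hom.hom this

end Thick

section Finiteness

variable {k : Type u} [Field k] {A : DGAlgebra.{u, v} k}

/-! ### Finiteness of cohomology and of morphism spaces -/

lemma finite_subquotient_congr {V : Type v} [AddCommGroup V] [Module k V] {Z Z' B B' : Submodule k V}
    (hZ : Z = Z') (hB : B = B') (h : Module.Finite k (Z' ⧸ B'.submoduleOf Z')) :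
    Module.Finite k (Z ⧸ B.submoduleOf Z) := by
  subst hZ hB
  exact h

lemma finite_of_exact {U V W : Type*} [AddCommGroup U] [Module k U] [AddCommGroup V] [Module k V]
    [AddCommGroup W] [Module k W] [Module.Finite k U] [Module.Finite k W] (f : U →ₗ[k] V)
    (g : V →ₗ[k] W) (h : ∀ x, g x = 0 → ∃ y, f y = x) : Module.Finite k V := by
  have hle : LinearMap.ker g ≤ LinearMap.range f := fun x hx => h x hx
  have : Module.Finite k (LinearMap.ker g) :=
    Module.Finite.of_injective (Submodule.inclusion hle) (Submodule.inclusion_injective hle)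
  have : Module.Finite k (V ⧸ LinearMap.ker g) :=
    Module.Finite.equiv g.quotKerEquivRange.symm
  exact Module.Finite.of_submodule_quotient (LinearMap.ker g)

variable (A) in
/-- The objects of `D(A)` with finite-dimensional cohomology in each degree. -/
def LocallyFinite : ObjectProperty (Derived A) :=
  fun X => ∀ i : ℤ, Module.Finite k ((derivedCohomology A i).obj X)

lemma locallyFinite_Q_iff {M : DGModule A} :
    LocallyFinite A ((Q A).obj M) ↔ ∀ i, Module.Finite k (M.cohomology i) := Iff.rfl

lemma isThick_locallyFinite : IsThick (LocallyFinite A) := by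
  have ret : ∀ X Y : Derived A, Retract X Y → LocallyFinite A Y → LocallyFinite A X := by
    intro X Y r h i
    have := h i
    refine Module.Finite.of_surjective ((derivedCohomology A i).map r.r).hom fun x =>
      ⟨((derivedCohomology A i).map r.i).hom x, ?_⟩
    rw [← LinearMap.comp_apply, ← ModuleCat.hom_comp, ← Functor.map_comp, r.retract]
    simp
  refine IsThick.of_middle ret ?_ ?_ ?_
  · rw [locallyFinite_Q_iff]
    intro i
    have : Subsingleton (dgCocycles (zeroModule A).gr (zeroModule A).d i) :=
      ⟨fun x y => Subtype.ext (Subsingleton.elim (α := PUnit) _ _)⟩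
    infer_instance
  · intro X h n
    obtain ⟨M, rfl⟩ : ∃ M, X = (Q A).obj M := ⟨X.as.obj, rfl⟩
    rw [locallyFinite_Q_iff] at h
    let e : ((Q A).obj M)⟦n⟧ ≅ (Q A).obj (M⟦n⟧) := ((Q A).commShiftIso n).symm.app M
    refine ret _ _ ⟨e.hom, e.inv, e.hom_inv_id⟩ ?_
    rw [locallyFinite_Q_iff]
    exact fun i => finite_subquotient_congr (cocycles_shift M n i) (coboundaries_shift M n i)
      (h (i + n))
  · intro M N f hM hC
    rw [locallyFinite_Q_iff] at hM hC ⊢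
    intro i
    have := hM i
    have := hC i
    refine finite_of_exact (cohomologyMap f i) (cohomologyMap (coneInl f) i) fun x hx => ?_
    obtain ⟨⟨n, hn⟩, rfl⟩ := Submodule.Quotient.mk_surjective _ x
    -- `n` bounds in the cone, `n = d y + f m` with `d m = 0`, so it is cohomologous to `f m`.
    obtain ⟨⟨y, m⟩, hy, e⟩ := (Submodule.Quotient.mk_eq_zero _).1 hx
    replace hy := (mem_cone_gr f (sub_add_cancel i 1)).1 hy
    have h1 : N.d y + Hom.lin f m = n := congrArg Prod.fst e
    have h2 : M.d m = 0 := neg_eq_zero.1 (congrArg Prod.snd e)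
    refine ⟨Submodule.Quotient.mk ⟨m, hy.2, h2⟩, (Submodule.Quotient.eq _).2 ?_⟩
    exact ⟨-y, Submodule.neg_mem _ hy.1, by
      rw [map_neg]
      change -N.d y = Hom.lin f m - n
      rw [← h1]
      abel⟩

variable (A) in
/-- The objects `X` of `D(A)` such that `Hom(X, Z)` is finite-dimensional whenever `Z` has
finite-dimensional cohomology in each degree. -/
def HomFinite : ObjectProperty (Derived A) :=
  fun X => ∀ Z, LocallyFinite A Z → Module.Finite k (X ⟶ Z)

lemma isThick_homFinite : IsThick (HomFinite A) := by
  have ret : ∀ X Y : Derived A, Retract X Y → HomFinite A Y → HomFinite A X := by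
    intro X Y r h Z hZ
    have := h Z hZ
    refine Module.Finite.of_surjective (Linear.leftComp k Z r.i) fun x => ⟨r.r ≫ x, ?_⟩
    rw [Linear.leftComp_apply, ← Category.assoc, r.retract, Category.id_comp]
  refine IsThick.of_middle ret ?_ ?_ ?_
  · intro Z _
    have hz : IsZero ((Q A).obj (zeroModule A)) := Functor.map_isZero _ isZero_zeroModule
    have : Subsingleton ((Q A).obj (zeroModule A) ⟶ Z) := ⟨hz.eq_of_src⟩
    infer_instance
  · intro X h n Z hZ
    have := h _ (isThick_locallyFinite.shift Z hZ (-n))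
    let e : X ≅ X⟦n⟧⟦-n⟧ := (shiftShiftNeg X n).symm
    exact Module.Finite.of_injective ((Linear.leftComp k (Z⟦-n⟧) e.hom).comp
      ((shiftFunctor (Derived A) (-n)).mapLinearMap k)) fun f g hfg =>
        (shiftFunctor (Derived A) (-n)).map_injective ((cancel_epi e.hom).1 hfg)
  · intro M N f hM hC Z hZ
    have := hM Z hZ
    have := hC Z hZ
    exact finite_of_exact (Linear.leftComp k Z ((Q A).map (coneInl f)))
      (Linear.leftComp k Z ((Q A).map f)) fun g hg => exists_comp_eq_of_comp_eq_zero f g hg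

lemma per_le_homFinite : per A ≤ HomFinite A := by
  refine per_le isThick_homFinite fun Z hZ => ?_
  obtain ⟨M, rfl⟩ : ∃ M, Z = (Q A).obj M := ⟨Z.as.obj, rfl⟩
  have := locallyFinite_Q_iff.1 hZ 0
  exact finite_hom_regular M

end Finiteness

section Truncation

variable {k : Type u} [CommRing k] {A : DGAlgebra.{u, v} k}

/-! ### Truncation -/

/-- An independent family induces a grading on its sum, here the range of `s`. -/
lemma isInternal_comap {V M : Type v} [AddCommGroup V] [Module k V] [AddCommGroup M] [Module k M]
    {s : V →ₗ[k] M} (hs : Function.Injective s) {T : ℤ → Submodule k M} (hT : iSupIndep T)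
    (hr : ⨆ i, T i = LinearMap.range s) : DirectSum.IsInternal (fun i => (T i).comap s) := by
  rw [DirectSum.isInternal_submodule_iff_iSupIndep_and_iSup_eq_top]
  constructor
  · intro i
    rw [Submodule.disjoint_def]
    intro x hx hx'
    refine hs ?_
    rw [map_zero]
    refine (Submodule.disjoint_def.1 (hT i)) _ hx ?_
    have hle : (⨆ (j) (_ : j ≠ i), (T j).comap s) ≤ (⨆ (j) (_ : j ≠ i), T j).comap s :=
      iSup₂_le fun j hj => Submodule.comap_mono (le_iSup₂ (f := fun j (_ : j ≠ i) => T j) j hj)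
    exact hle hx'
  · refine Submodule.map_injective_of_injective hs ?_
    rw [Submodule.map_iSup, Submodule.map_top, ← hr]
    refine iSup_congr fun i => ?_
    rw [Submodule.map_comap_eq, ← hr]
    exact inf_eq_right.2 (le_iSup T i)

/-- The induction principle for a graded module. -/
lemma gr_induction (M : DGModule A) {p : M.carrier → Prop} (x : M.carrier)
    (mem : ∀ i, ∀ y ∈ M.gr i, p y) (add : ∀ y z, p y → p z → p (y + z)) : p x := by
  have hx : x ∈ ⨆ i, M.gr i := by
    rw [M.isInternal.submodule_iSup_eq_top]
    trivial
  exact Submodule.iSup_induction M.gr (motive := p) hx mem (mem 0 0 (Submodule.zero_mem _)) add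

/-- The right `A`-submodule spanned by graded pieces `T i` which are stable under `A`. -/
def spanSubmodule (M : DGModule A) (T : ℤ → Submodule k M.carrier)
    (hsmul : ∀ (i j : ℤ), ∀ x ∈ T i, ∀ a ∈ A.gr j, x <• a ∈ T (i + j)) :
    Submodule (A.carrier)ᵐᵒᵖ M.carrier where
  carrier := (⨆ i, T i : Submodule k M.carrier)
  add_mem' := Submodule.add_mem _
  zero_mem' := Submodule.zero_mem _
  smul_mem' c x hx := by
    refine Submodule.iSup_induction T (motive := fun x => c • x ∈ ⨆ i, T i) hx (fun i y hy => ?_)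
      (by rw [smul_zero]; exact Submodule.zero_mem _)
      (fun y z hy hz => by rw [smul_add]; exact Submodule.add_mem _ hy hz)
    refine gr_induction (regular A) (p := fun a : A.carrier => y <• a ∈ ⨆ i, T i) c.unop
      (fun j a ha => Submodule.mem_iSup_of_mem _ (hsmul i j y hy a ha)) (fun a b ha hb => ?_)
    have e : y <• ((show A.carrier from a) + (show A.carrier from b)) =
        y <• (show A.carrier from a) + y <• (show A.carrier from b) := by
      rw [MulOpposite.op_add, add_smul]
    exact e ▸ Submodule.add_mem _ ha hb

/-- The dg submodule with given graded pieces. -/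
def subModule (M : DGModule A) (T : ℤ → Submodule k M.carrier) (hT : ∀ i, T i ≤ M.gr i)
    (hsmul : ∀ (i j : ℤ), ∀ x ∈ T i, ∀ a ∈ A.gr j, x <• a ∈ T (i + j))
    (hd : ∀ i, ∀ x ∈ T i, M.d x ∈ T (i + 1)) : DGModule A where
  carrier := spanSubmodule M T hsmul
  gr i := (T i).comap ((spanSubmodule M T hsmul).subtype.restrictScalars k)
  isInternal := isInternal_comap (s := (spanSubmodule M T hsmul).subtype.restrictScalars k)
    Subtype.val_injective (M.isInternal.submodule_iSupIndep.mono hT) (by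
      ext x
      exact ⟨fun h => ⟨⟨x, h⟩, rfl⟩, by rintro ⟨y, rfl⟩; exact y.2⟩)
  smul_mem hm ha := hsmul _ _ _ hm _ ha
  d := M.d.restrict (p := ⨆ i, T i) (q := ⨆ i, T i) fun x hx =>
    Submodule.iSup_induction T (motive := fun x => M.d x ∈ ⨆ i, T i) hx
      (fun i y hy => Submodule.mem_iSup_of_mem _ (hd i y hy))
      (by rw [map_zero]; exact Submodule.zero_mem _)
      (fun y z hy hz => by rw [map_add]; exact Submodule.add_mem _ hy hz)
  d_mem hm := hd _ _ hm
  d_d x := Subtype.ext (M.d_d x.1)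
  leibniz {i m} hm a := Subtype.ext (by
    refine (M.leibniz (hT i hm) a).trans ?_
    rcases Int.units_eq_one_or (Int.negOnePow i) with h | h <;> simp [h] <;> rfl)

lemma smul_eq_zero_of_pos (nonpositive : ∀ i : ℤ, 0 < i → A.gr i = ⊥) {M : DGModule A} {j : ℤ}
    (hj : 0 < j) {a : A.carrier} (ha : a ∈ A.gr j) (x : M.carrier) : x <• a = 0 := by
  rw [nonpositive j hj, Submodule.mem_bot] at ha
  rw [ha, MulOpposite.op_zero, zero_smul]

lemma d_eq_zero_of_mem_zero (nonpositive : ∀ i : ℤ, 0 < i → A.gr i = ⊥) {a : A.carrier}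
    (ha : a ∈ A.gr 0) : A.d a = 0 := by
  have := A.d_mem ha
  rwa [nonpositive _ (by lia), Submodule.mem_bot] at this

/-- The truncation `τ^{≤ m} M`: it agrees with `M` below `m` and consists of the cocycles in degree
`m`. It is stable under `A` because `A` is concentrated in nonpositive degrees. -/
lemma exists_truncation (nonpositive : ∀ i : ℤ, 0 < i → A.gr i = ⊥) (M : DGModule A) (m : ℤ) :
    ∃ (X : DGModule A) (f : X ⟶ M), Function.Injective (Hom.lin f) ∧
      (∀ i, m < i → X.gr i = ⊥) ∧
      ∀ i ≤ m, ∀ x ∈ M.gr i, (i = m → M.d x = 0) → ∃ y ∈ X.gr i, Hom.lin f y = x := by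
  let T : ℤ → Submodule k M.carrier := fun i =>
    if i < m then M.gr i else if i = m then dgCocycles M.gr M.d i else ⊥
  have hlt : ∀ i, i < m → T i = M.gr i := fun i h => if_pos h
  have heq : T m = dgCocycles M.gr M.d m := by simp [T]
  have hgt : ∀ i, m < i → T i = ⊥ := fun i h => by simp [T, h.not_gt, h.ne']
  have hT : ∀ i, T i ≤ M.gr i := fun i => by
    rcases lt_trichotomy i m with h | rfl | h
    · rw [hlt i h]
    · rw [heq]; exact inf_le_left
    · rw [hgt i h]; exact bot_le
  have hsmul : ∀ (i j : ℤ), ∀ x ∈ T i, ∀ a ∈ A.gr j, x <• a ∈ T (i + j) := by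
    intro i j x hx a ha
    rcases lt_trichotomy 0 j with hj | rfl | hj
    · rw [smul_eq_zero_of_pos nonpositive hj ha]
      exact Submodule.zero_mem _
    · rw [add_zero]
      rcases lt_trichotomy i m with h | rfl | h
      · rw [hlt i h] at hx ⊢
        have := M.smul_mem hx ha
        rwa [add_zero] at this
      · rw [heq] at hx ⊢
        have := M.smul_mem hx.1 ha
        rw [add_zero] at this
        refine ⟨this, ?_⟩
        have hd : M.d x = 0 := hx.2
        change M.d (x <• a) = 0
        rw [M.leibniz hx.1, hd, d_eq_zero_of_mem_zero nonpositive ha]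
        simp
      · rw [hgt i h, Submodule.mem_bot] at hx
        rw [hx, smul_zero]
        exact Submodule.zero_mem _
    · rcases le_or_gt i m with h | h
      · rw [hlt (i + j) (by lia)]
        exact M.smul_mem (hT i hx) ha
      · rw [hgt i h, Submodule.mem_bot] at hx
        rw [hx, smul_zero]
        exact Submodule.zero_mem _
  have hd : ∀ i, ∀ x ∈ T i, M.d x ∈ T (i + 1) := by
    intro i x hx
    rcases lt_trichotomy (i + 1) m with h | h | h
    · rw [hlt _ h]
      exact M.d_mem (hT i hx)
    · rw [h, heq, ← h]
      exact ⟨M.d_mem (hT i hx), M.d_d x⟩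
    · have hx0 : M.d x = 0 := by
        rcases (show m ≤ i by lia).eq_or_lt with rfl | h'
        · rw [heq] at hx
          exact hx.2
        · rw [hgt i h', Submodule.mem_bot] at hx
          rw [hx, map_zero]
      rw [hx0]
      exact Submodule.zero_mem _
  refine ⟨subModule M T hT hsmul hd, Hom.mk (M := subModule M T hT hsmul hd)
    (spanSubmodule M T hsmul).subtype (fun i x hx => hT i hx) (fun _ => rfl),
    Subtype.val_injective, fun i h => ?_, fun i hi x hx hx' => ?_⟩
  · refine (Submodule.eq_bot_iff _).2 fun x hx => Subtype.ext ?_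
    replace hx : x.1 ∈ T i := hx
    rwa [hgt i h, Submodule.mem_bot] at hx
  · have hxT : x ∈ T i := by
      rcases hi.eq_or_lt with rfl | h
      · rw [heq]
        exact ⟨hx, hx' rfl⟩
      · rwa [hlt i h]
    exact ⟨⟨x, Submodule.mem_iSup_of_mem i hxT⟩, hxT, rfl⟩

/-- The homogeneous components of a cocycle are cocycles. -/
lemma mem_iSup_cocycles (M : DGModule A) {x : M.carrier} (hx : M.d x = 0) :
    x ∈ ⨆ i, dgCocycles M.gr M.d i := by
  have hx' : x ∈ ⨆ i, M.gr i := by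
    rw [M.isInternal.submodule_iSup_eq_top]
    trivial
  obtain ⟨f, hf, rfl⟩ := (Submodule.mem_iSup_iff_exists_finsupp _ _).1 hx'
  rw [Finsupp.sum, map_sum] at hx
  have hi := (iSupIndep_iff_finsetSum_eq_zero_imp_eq_zero _).1
    (M.isInternal.submodule_iSupIndep.comp (add_left_injective 1)) f.support
    (fun i => M.d (f i)) (fun i _ => M.d_mem (hf i)) hx
  exact Submodule.sum_mem _ fun i h => Submodule.mem_iSup_of_mem i ⟨hf i, hi i h⟩

/-- The total cohomology is finite as soon as the `H^i` are finite and almost all of them vanish. -/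
lemma finite_dgTotalCohomology (M : DGModule A) (s : Finset ℤ)
    (h : ∀ i, Module.Finite k (M.cohomology i))
    (hs : ∀ i ∉ s, ∀ x ∈ dgCocycles M.gr M.d i, x ∈ dgCoboundaries M.gr M.d i) :
    Module.Finite k (dgTotalCohomology M.d) := by
  let ι : ∀ i, M.cohomology i →ₗ[k] dgTotalCohomology M.d := fun i =>
    Submodule.mapQ _ _ (Submodule.inclusion inf_le_right) (by
      rintro x ⟨y, -, hy⟩
      exact ⟨y, hy⟩)
  have hfg : (⨆ i ∈ s, LinearMap.range (ι i)).FG := Submodule.fg_biSup s _ fun i _ => by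
    have := h i
    exact Module.Finite.iff_fg.1 inferInstance
  refine ⟨?_⟩
  convert hfg
  refine (eq_top_iff.2 ?_).symm
  rintro x -
  obtain ⟨⟨x, hx⟩, rfl⟩ := Submodule.Quotient.mk_surjective _ x
  have key : ∀ x ∈ ⨆ i, dgCocycles M.gr M.d i, ∃ hx : M.d x = 0,
      (Submodule.Quotient.mk ⟨x, hx⟩ : dgTotalCohomology M.d) ∈ ⨆ i ∈ s, LinearMap.range (ι i) := by
    intro x hx
    refine Submodule.iSup_induction _ (motive := fun x => ∃ hx : M.d x = 0,
      (Submodule.Quotient.mk ⟨x, hx⟩ : dgTotalCohomology M.d) ∈ ⨆ i ∈ s, LinearMap.range (ι i)) hx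
      ?_ ?_ ?_
    · intro i x hx
      refine ⟨hx.2, ?_⟩
      by_cases hi : i ∈ s
      · exact le_iSup₂ (f := fun i (_ : i ∈ s) => LinearMap.range (ι i)) i hi
          ⟨Submodule.Quotient.mk ⟨x, hx⟩, rfl⟩
      · obtain ⟨y, -, hy⟩ := hs i hi x hx
        have hz : (Submodule.Quotient.mk ⟨x, hx.2⟩ : dgTotalCohomology M.d) = 0 :=
          (Submodule.Quotient.mk_eq_zero _).2 ⟨y, hy⟩
        rw [hz]
        exact Submodule.zero_mem _
    · exact ⟨map_zero _, Submodule.zero_mem _⟩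
    · rintro x y ⟨hx, hx'⟩ ⟨hy, hy'⟩
      exact ⟨by rw [map_add, hx, hy, add_zero], Submodule.add_mem _ hx' hy'⟩
  exact (key x (mem_iSup_cocycles M hx)).2

/-- The cone of the inclusion of `τ^{≤ m} M`, which computes `τ^{> m} M`, has finite total
cohomology if `H^i(M)` is finite for `i > m` and zero for large `i`. -/
lemma finite_dgTotalCohomology_cone {X M : DGModule A} (f : X ⟶ M)
    (hf : Function.Injective (Hom.lin f)) (m n : ℤ) (hX : ∀ i, m < i → X.gr i = ⊥)
    (hfm : ∀ i ≤ m, ∀ x ∈ M.gr i, (i = m → M.d x = 0) → ∃ y ∈ X.gr i, Hom.lin f y = x)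
    (hM : ∀ i, n < i → M.gr i = ⊥) (fin : ∀ i, m < i → Module.Finite k (M.cohomology i)) :
    Module.Finite k (dgTotalCohomology (cone f).d) := by
  -- In degrees at most `m` a cocycle `(a, x)` of the cone is the boundary of `(0, a)`.
  have low : ∀ i ≤ m, ∀ x ∈ dgCocycles (cone f).gr (cone f).d i,
      x ∈ dgCoboundaries (cone f).gr (cone f).d i := by
    rintro i hi ⟨a, x⟩ ⟨hax, hd⟩
    replace hax := (mem_cone_gr f rfl).1 hax
    have h1 : M.d a + Hom.lin f x = 0 := congrArg Prod.fst hd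
    obtain ⟨y, hy, rfl⟩ := hfm i hi a hax.1 (by
      rintro rfl
      have hx := hax.2
      rw [hX _ (by lia), Submodule.mem_bot] at hx
      rwa [hx, map_zero, add_zero] at h1)
    refine ⟨((0 : M.carrier), y), (mem_cone_gr f (sub_add_cancel i 1)).2
      ⟨Submodule.zero_mem _, hy⟩, Prod.ext ?_ ?_⟩
    · change M.d 0 + Hom.lin f y = Hom.lin f y
      rw [map_zero, zero_add]
    · change -X.d y = x
      refine hf ?_
      rw [map_neg, Hom.comm]
      exact neg_eq_of_add_eq_zero_right h1
  have high : ∀ i, m < i → Function.Surjective (cohomologyMap (coneInl f) i) := by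
    intro i hi x
    obtain ⟨⟨⟨a, x⟩, hax, hd⟩, rfl⟩ := Submodule.Quotient.mk_surjective _ x
    have hx := ((mem_cone_gr f rfl).1 hax).2
    rw [hX _ (by lia), Submodule.mem_bot] at hx
    subst hx
    have h1 : M.d a + Hom.lin f 0 = 0 := congrArg Prod.fst hd
    rw [map_zero, add_zero] at h1
    exact ⟨Submodule.Quotient.mk ⟨a, ((mem_cone_gr f rfl).1 hax).1, h1⟩, rfl⟩
  refine finite_dgTotalCohomology _ (Finset.Ioc m n) (fun i => ?_) (fun i hi => ?_)
  · rcases le_or_gt i m with h | h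
    · have : Subsingleton ((cone f).cohomology i) := by
        refine subsingleton_of_forall_eq 0 fun x => ?_
        obtain ⟨⟨x, hx⟩, rfl⟩ := Submodule.Quotient.mk_surjective _ x
        exact (Submodule.Quotient.mk_eq_zero _).2 (low i h x hx)
      infer_instance
    · have := fin i h
      exact Module.Finite.of_surjective _ (high i h)
  · rcases le_or_gt i m with h | h
    · exact low i h
    · rintro ⟨a, x⟩ ⟨hax, -⟩
      have hax := (mem_cone_gr f rfl).1 hax
      rw [Finset.mem_Ioc] at hi
      rw [hX _ (by lia), hM _ (by lia), Submodule.mem_bot, Submodule.mem_bot] at hax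
      obtain ⟨rfl, rfl⟩ := hax
      exact Submodule.zero_mem _

end Truncation

section TopCohomology

variable {k : Type u} [Field k] {A : DGAlgebra.{u, v} k}

/-! ### The top cohomology of a perfect dg module -/

/-- The submodule `(⨁_{j ≠ m} M^j) + B^m`. If `M` vanishes above degree `m`, the quotient by it is
`H^m(M)`. -/
def topKernel (M : DGModule A) (m : ℤ) : Submodule k M.carrier :=
  (⨆ (j : ℤ) (_ : j ≠ m), M.gr j) ⊔ dgCoboundaries M.gr M.d m

lemma gr_le_topKernel (M : DGModule A) {m j : ℤ} (h : j ≠ m) :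
    M.gr j ≤ M.topKernel m :=
  le_sup_of_le_left (le_iSup₂ (f := fun j (_ : j ≠ m) => M.gr j) j h)

lemma d_mem_topKernel (M : DGModule A) (m : ℤ) (x : M.carrier) :
    M.d x ∈ M.topKernel m := by
  refine gr_induction M (p := fun x => M.d x ∈ M.topKernel m) x (fun i y hy => ?_)
    (fun y z hy hz => by rw [map_add]; exact Submodule.add_mem _ hy hz)
  by_cases h : i + 1 = m
  · obtain rfl : i = m - 1 := by lia
    exact Submodule.mem_sup_right ⟨y, hy, rfl⟩
  · exact gr_le_topKernel M h (M.d_mem hy)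

lemma mem_coboundaries_of_mem_topKernel (M : DGModule A) {m : ℤ} {x : M.carrier} (hx : x ∈ M.gr m)
    (hx' : x ∈ M.topKernel m) : x ∈ dgCoboundaries M.gr M.d m := by
  obtain ⟨y, hy, _, ⟨w, hw, rfl⟩, rfl⟩ := Submodule.mem_sup.1 hx'
  have hdw : M.d w ∈ M.gr m := by
    have := M.d_mem hw
    rwa [sub_add_cancel] at this
  have hy0 : y = 0 := by
    refine Submodule.disjoint_def.1 (M.isInternal.submodule_iSupIndep m) y ?_ hy
    have := Submodule.sub_mem _ hx hdw
    rwa [add_sub_cancel_right] at this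
  rw [hy0, zero_add]
  exact ⟨w, hw, rfl⟩

lemma topKernel_induction (M : DGModule A) {m : ℤ} {p : M.carrier → Prop} {x : M.carrier}
    (hx : x ∈ M.topKernel m) (off : ∀ j, j ≠ m → ∀ y ∈ M.gr j, p y)
    (cob : ∀ y ∈ M.gr (m - 1), p (M.d y)) (add : ∀ y z, p y → p z → p (y + z)) : p x := by
  obtain ⟨y, hy, _, ⟨w, hw, rfl⟩, rfl⟩ := Submodule.mem_sup.1 hx
  refine add _ _ ?_ (cob w hw)
  rw [iSup_subtype'] at hy
  exact Submodule.iSup_induction _ (motive := p) hy (fun j z hz => off j.1 j.2 z hz)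
    (off (m + 1) (by lia) 0 (Submodule.zero_mem _)) add

lemma smul_mem_of_forall_gr (M : DGModule A) (U : Submodule k M.carrier) (x : M.carrier)
    (a : A.carrier) (h : ∀ j, ∀ b ∈ A.gr j, x <• b ∈ U) : x <• a ∈ U := by
  refine gr_induction (regular A) (p := fun b : A.carrier => x <• b ∈ U) a h fun b c hb hc => ?_
  have e : x <• ((show A.carrier from b) + (show A.carrier from c)) =
      x <• (show A.carrier from b) + x <• (show A.carrier from c) := by
    rw [MulOpposite.op_add, add_smul]
  exact e ▸ Submodule.add_mem _ hb hc

/-- The action of `A` descends to the top cohomology. -/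
lemma smul_mem_topKernel (nonpositive : ∀ i : ℤ, 0 < i → A.gr i = ⊥) {M : DGModule A}
    {m : ℤ} (hM : ∀ i, m < i → M.gr i = ⊥) {x : M.carrier} (hx : x ∈ M.topKernel m)
    (a : A.carrier) : x <• a ∈ M.topKernel m := by
  refine smul_mem_of_forall_gr M _ x a fun j b hb => ?_
  rcases lt_or_ge 0 j with hj | hj
  · rw [smul_eq_zero_of_pos nonpositive hj hb]
    exact Submodule.zero_mem _
  refine topKernel_induction M (p := fun x => x <• b ∈ M.topKernel m) hx ?_ ?_
    (fun y z hy hz => by rw [smul_add]; exact Submodule.add_mem _ hy hz)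
  · intro i hi y hy
    rcases lt_or_gt_of_ne hi with h | h
    · exact gr_le_topKernel M (by lia) (M.smul_mem hy hb)
    · rw [hM i h, Submodule.mem_bot] at hy
      rw [hy, smul_zero]
      exact Submodule.zero_mem _
  · intro y hy
    rcases hj.eq_or_lt with rfl | hj
    · have := M.leibniz hy b
      rw [d_eq_zero_of_mem_zero nonpositive hb, MulOpposite.op_zero, zero_smul, smul_zero,
        add_zero] at this
      rw [← this]
      exact d_mem_topKernel M m _
    · exact gr_le_topKernel M (by lia) (M.smul_mem (M.d_mem hy) hb)

/-- The action on the top cohomology factors through `H^0(A)`. -/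
lemma smul_mem_topKernel_of_mem_regular (nonpositive : ∀ i : ℤ, 0 < i → A.gr i = ⊥) {M : DGModule A}
    {m : ℤ} (hM : ∀ i, m < i → M.gr i = ⊥) (x : M.carrier) {a : A.carrier}
    (ha : a ∈ (regular A).topKernel 0) : x <• a ∈ M.topKernel m := by
  refine gr_induction M (p := fun x => x <• a ∈ M.topKernel m) x (fun i y hy => ?_)
    (fun y z hy hz => by rw [smul_add]; exact Submodule.add_mem _ hy hz)
  rcases lt_or_ge m i with hi | hi
  · rw [hM i hi, Submodule.mem_bot] at hy
    rw [hy, smul_zero]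
    exact Submodule.zero_mem _
  refine topKernel_induction (regular A)
    (p := fun b : A.carrier => y <• b ∈ M.topKernel m) ha ?_ ?_ ?_
  · intro j hj b hb
    rcases lt_or_gt_of_ne hj with h | h
    · exact gr_le_topKernel M (by lia) (M.smul_mem hy hb)
    · rw [smul_eq_zero_of_pos nonpositive h hb]
      exact Submodule.zero_mem _
  · intro (b : A.carrier) hb
    change y <• A.d b ∈ _
    rcases hi.eq_or_lt with rfl | hi
    · have h0 : M.d y = 0 := by
        have := M.d_mem hy
        rwa [hM _ (by lia), Submodule.mem_bot] at this
      have := M.leibniz hy b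
      rw [h0, smul_zero, zero_add] at this
      have h' : y <• A.d b = Int.negOnePow i • M.d (y <• b) := by
        rw [this, smul_smul, Int.units_mul_self, one_smul]
      rw [h']
      exact negOnePow_smul_mem _ _ (d_mem_topKernel M i _)
    · have := M.smul_mem hy (A.d_mem hb)
      exact gr_le_topKernel M (by lia) this
  · intro (b : A.carrier) (c : A.carrier) hb hc
    change y <• (b + c) ∈ _
    rw [MulOpposite.op_add, add_smul]
    exact Submodule.add_mem _ hb hc

/-- If `M` vanishes above degree `m`, this is `H^m(M)`. -/
abbrev topCohomology (M : DGModule A) (m : ℤ) : Type v := M.carrier ⧸ M.topKernel m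

lemma finite_top_of_finite_cohomology (M : DGModule A) {m : ℤ} (hM : M.gr (m + 1) = ⊥)
    [Module.Finite k (M.cohomology m)] : Module.Finite k (M.topCohomology m) := by
  let φ : M.cohomology m →ₗ[k] M.topCohomology m :=
    Submodule.liftQ _ ((M.topKernel m).mkQ.comp (Submodule.subtype _)) fun x hx =>
      (Submodule.Quotient.mk_eq_zero _).2 (Submodule.mem_sup_right hx)
  refine Module.Finite.of_surjective φ fun x => ?_
  obtain ⟨x, rfl⟩ := Submodule.Quotient.mk_surjective _ x
  change _ ∈ LinearMap.range φ
  refine gr_induction M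
    (p := fun x => (Submodule.Quotient.mk x : M.topCohomology m) ∈ LinearMap.range φ) x
    (fun i y hy => ?_) (fun y z hy hz => Submodule.add_mem _ hy hz)
  by_cases h : i = m
  · subst h
    have hd := M.d_mem hy
    rw [hM, Submodule.mem_bot] at hd
    exact ⟨Submodule.Quotient.mk ⟨y, hy, hd⟩, rfl⟩
  · have : (Submodule.Quotient.mk y : M.topCohomology m) = 0 :=
      (Submodule.Quotient.mk_eq_zero _).2 (gr_le_topKernel M h hy)
    exact this ▸ Submodule.zero_mem _

lemma finite_cohomology_of_finite_top (M : DGModule A) (m : ℤ)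
    [Module.Finite k (M.topCohomology m)] :
    Module.Finite k (M.cohomology m) := by
  let φ : M.cohomology m →ₗ[k] M.topCohomology m :=
    Submodule.liftQ _ ((M.topKernel m).mkQ.comp (Submodule.subtype _)) fun x hx =>
      (Submodule.Quotient.mk_eq_zero _).2 (Submodule.mem_sup_right hx)
  refine Module.Finite.of_injective φ ((injective_iff_map_eq_zero _).2 fun x => ?_)
  obtain ⟨⟨x, hx⟩, rfl⟩ := Submodule.Quotient.mk_surjective _ x
  intro h
  exact (Submodule.Quotient.mk_eq_zero _).2
    (mem_coboundaries_of_mem_topKernel M hx.1 ((Submodule.Quotient.mk_eq_zero _).1 h))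

/-- The map `H^0(A) → H^m(M)` given by the action on an element of `M`, for `M` vanishing above
degree `m`. -/
def topSMul (nonpositive : ∀ i : ℤ, 0 < i → A.gr i = ⊥) {M : DGModule A} {m : ℤ}
    (hM : ∀ i, m < i → M.gr i = ⊥) :
    M.carrier →ₗ[k] (regular A).topCohomology 0 →ₗ[k] M.topCohomology m where
  toFun x := Submodule.mapQ _ _ ((smulLin M x).restrictScalars k)
    fun _ ha => smul_mem_topKernel_of_mem_regular nonpositive hM x ha
  map_add' x y := by
    refine Submodule.linearMap_qext _ (LinearMap.ext fun a => ?_)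
    exact congrArg (Submodule.Quotient.mk (p := M.topKernel m))
      (smul_add (MulOpposite.op (show A.carrier from a)) x y)
  map_smul' c x := by
    refine Submodule.linearMap_qext _ (LinearMap.ext fun a => ?_)
    exact congrArg (Submodule.Quotient.mk (p := M.topKernel m))
      (smul_comm (MulOpposite.op (show A.carrier from a)) c x)

lemma topSMul_mk (nonpositive : ∀ i : ℤ, 0 < i → A.gr i = ⊥) {M : DGModule A} {m : ℤ}
    (hM : ∀ i, m < i → M.gr i = ⊥) (x : M.carrier) (a : A.carrier) :
    topSMul nonpositive hM x (Submodule.Quotient.mk a) = Submodule.Quotient.mk (x <• a) := rfl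

lemma topSMul_eq_zero (nonpositive : ∀ i : ℤ, 0 < i → A.gr i = ⊥) {M : DGModule A} {m : ℤ}
    (hM : ∀ i, m < i → M.gr i = ⊥) {x : M.carrier} (hx : x ∈ M.topKernel m) :
    topSMul nonpositive hM x = 0 := by
  refine Submodule.linearMap_qext _ (LinearMap.ext fun a => ?_)
  exact (Submodule.Quotient.mk_eq_zero _).2 (smul_mem_topKernel nonpositive hM hx a)

/-- The left multiplication by an element of `A` on `H^0(A)`. -/
def leftMul (nonpositive : ∀ i : ℤ, 0 < i → A.gr i = ⊥) :
    A.carrier →ₗ[k] (regular A).topCohomology 0 →ₗ[k] (regular A).topCohomology 0 :=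
  topSMul nonpositive (M := regular A) nonpositive

lemma leftMul_one (nonpositive : ∀ i : ℤ, 0 < i → A.gr i = ⊥) :
    leftMul nonpositive 1 = LinearMap.id := by
  refine Submodule.linearMap_qext _ (LinearMap.ext fun a => ?_)
  exact congrArg (Submodule.Quotient.mk (p := (regular A).topKernel 0))
    (one_mul (show A.carrier from a))

lemma topSMul_smul (nonpositive : ∀ i : ℤ, 0 < i → A.gr i = ⊥) {M : DGModule A} {m : ℤ}
    (hM : ∀ i, m < i → M.gr i = ⊥) (x : M.carrier) (a : A.carrier) :
    topSMul nonpositive hM (x <• a) = (topSMul nonpositive hM x).comp (leftMul nonpositive a) := by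
  refine Submodule.linearMap_qext _ (LinearMap.ext fun b => ?_)
  refine congrArg (Submodule.Quotient.mk (p := M.topKernel m)) ?_
  exact smul_smul (MulOpposite.op (show A.carrier from b)) (MulOpposite.op a) x

lemma leftMul_mul (nonpositive : ∀ i : ℤ, 0 < i → A.gr i = ⊥) (a b : A.carrier) :
    leftMul nonpositive (a * b) = (leftMul nonpositive a).comp (leftMul nonpositive b) :=
  topSMul_smul nonpositive (M := regular A) nonpositive a b

lemma isInternal_concentrated (V : Type v) [AddCommGroup V] [Module k V] (m : ℤ) :
    DirectSum.IsInternal (fun i : ℤ => if i = m then (⊤ : Submodule k V) else ⊥) := by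
  rw [DirectSum.isInternal_submodule_iff_iSupIndep_and_iSup_eq_top]
  constructor
  · intro i
    by_cases h : i = m
    · have : (⨆ (j : ℤ) (_ : j ≠ i), if j = m then (⊤ : Submodule k V) else ⊥) = ⊥ :=
        iSup₂_eq_bot.2 fun j hj => if_neg (by lia)
      rw [this]
      exact disjoint_bot_right
    · change Disjoint (ite (i = m) ⊤ ⊥) _
      rw [if_neg h]
      exact disjoint_bot_left
  · refine eq_top_iff.2 (le_iSup_of_le m ?_)
    rw [if_pos rfl]

/-- The right action of `A` on the `k`-dual of the left module `H^0(A)`, transported to the space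
`H^0(A)` by a linear isomorphism `e` with the dual, which keeps it in the universe of `A`. -/
abbrev dualTopAction (nonpositive : ∀ i : ℤ, 0 < i → A.gr i = ⊥)
    (e : (regular A).topCohomology 0 ≃ₗ[k] Module.Dual k ((regular A).topCohomology 0)) :
    Module (A.carrier)ᵐᵒᵖ ((regular A).topCohomology 0) :=
  { smul := fun c x => e.symm ((e x).comp (leftMul nonpositive c.unop))
    one_smul := fun x => by
      change e.symm ((e x).comp (leftMul nonpositive 1)) = x
      rw [leftMul_one, LinearMap.comp_id, e.symm_apply_apply]
    mul_smul := fun c c' x => by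
      change e.symm ((e x).comp (leftMul nonpositive (c'.unop * c.unop))) =
        e.symm ((e (e.symm ((e x).comp (leftMul nonpositive c'.unop)))).comp
          (leftMul nonpositive c.unop))
      rw [leftMul_mul, e.apply_symm_apply, LinearMap.comp_assoc]
    smul_zero := fun c => by
      change e.symm ((e 0).comp (leftMul nonpositive c.unop)) = 0
      rw [map_zero, LinearMap.zero_comp, map_zero]
    smul_add := fun c x y => by
      change e.symm ((e (x + y)).comp (leftMul nonpositive c.unop)) =
        e.symm ((e x).comp (leftMul nonpositive c.unop)) +
          e.symm ((e y).comp (leftMul nonpositive c.unop))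
      rw [map_add, LinearMap.add_comp, map_add]
    add_smul := fun c c' x => by
      change e.symm ((e x).comp (leftMul nonpositive (c.unop + c'.unop))) =
        e.symm ((e x).comp (leftMul nonpositive c.unop)) +
          e.symm ((e x).comp (leftMul nonpositive c'.unop))
      rw [map_add, LinearMap.comp_add, map_add]
    zero_smul := fun x => by
      change e.symm ((e x).comp (leftMul nonpositive 0)) = 0
      rw [map_zero, LinearMap.comp_zero, map_zero] }

/-- The `k`-dual of the left module `H^0(A)`, as a right dg module concentrated in degree `m`. -/
def dualTop (nonpositive : ∀ i : ℤ, 0 < i → A.gr i = ⊥)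
    (e : (regular A).topCohomology 0 ≃ₗ[k] Module.Dual k ((regular A).topCohomology 0)) (m : ℤ) :
    DGModule A where
  carrier := (regular A).topCohomology 0
  rightModule := dualTopAction nonpositive e
  isScalarTower := letI := dualTopAction nonpositive e; ⟨fun r c x => by
    change e.symm ((e x).comp (leftMul nonpositive (r • c.unop))) =
      r • e.symm ((e x).comp (leftMul nonpositive c.unop))
    rw [map_smul, LinearMap.comp_smul, map_smul]⟩
  gr i := if i = m then ⊤ else ⊥
  isInternal := isInternal_concentrated _ m
  smul_mem {i j x a} hx ha := by
    change e.symm ((e x).comp (leftMul nonpositive a)) ∈ _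
    by_cases hi : i = m
    · by_cases hj : j = 0
      · rw [if_pos (by lia)]
        trivial
      · have : leftMul nonpositive a = 0 := topSMul_eq_zero nonpositive (M := regular A) nonpositive
          (gr_le_topKernel (regular A) hj ha)
        rw [this, LinearMap.comp_zero, map_zero]
        exact Submodule.zero_mem _
    · rw [if_neg hi, Submodule.mem_bot] at hx
      rw [hx, map_zero, LinearMap.zero_comp, map_zero]
      exact Submodule.zero_mem _
  d := 0
  d_mem _ := Submodule.zero_mem _
  d_d _ := rfl
  leibniz {i x} hx a := by
    have h0 : leftMul nonpositive (A.d a) = 0 :=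
      topSMul_eq_zero nonpositive (M := regular A) nonpositive
        (d_mem_topKernel (regular A) 0 a)
    have h : e.symm ((e x).comp (leftMul nonpositive (A.d a))) = 0 := by
      rw [h0, LinearMap.comp_zero, map_zero]
    change 0 = e.symm ((e 0).comp (leftMul nonpositive a)) +
      Int.negOnePow i • e.symm ((e x).comp (leftMul nonpositive (A.d a)))
    rw [h, map_zero, LinearMap.zero_comp, map_zero, smul_zero, add_zero]

/-- A functional `η` on `H^m(M)`, for `M` vanishing above degree `m`, gives the morphism
`x ↦ (a ↦ η (x a))` to the dual of `H^0(A)`. -/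
def toDualTop (nonpositive : ∀ i : ℤ, 0 < i → A.gr i = ⊥)
    (e : (regular A).topCohomology 0 ≃ₗ[k] Module.Dual k ((regular A).topCohomology 0))
    {M : DGModule A} {m : ℤ}
    (hM : ∀ i, m < i → M.gr i = ⊥) :
    Module.Dual k (M.topCohomology m) →ₗ[k] (M ⟶ dualTop nonpositive e m) where
  toFun η := Hom.mk (N := dualTop nonpositive e m)
    { toFun := fun x => e.symm (η.comp (topSMul nonpositive hM x))
      map_add' := fun x y => by
        rw [map_add, LinearMap.comp_add, map_add]
        rfl
      map_smul' := fun c x => by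
        change e.symm (η.comp (topSMul nonpositive hM (x <• c.unop))) =
          e.symm ((e (e.symm (η.comp (topSMul nonpositive hM x)))).comp
            (leftMul nonpositive c.unop))
        rw [topSMul_smul, e.apply_symm_apply, LinearMap.comp_assoc] }
    (fun i x hx => by
      change e.symm (η.comp (topSMul nonpositive hM x)) ∈
        (if i = m then ⊤ else ⊥ : Submodule k ((regular A).topCohomology 0))
      by_cases h : i = m
      · rw [if_pos h]
        trivial
      · rw [topSMul_eq_zero nonpositive hM (gr_le_topKernel M h hx), LinearMap.comp_zero,
          map_zero]
        exact Submodule.zero_mem _)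
    (fun x => by
      change e.symm (η.comp (topSMul nonpositive hM (M.d x))) = 0
      rw [topSMul_eq_zero nonpositive hM (d_mem_topKernel M m x), LinearMap.comp_zero,
        map_zero])
  map_add' η η' := hom_ext fun x => by
    change e.symm ((η + η').comp (topSMul nonpositive hM x)) =
      e.symm (η.comp (topSMul nonpositive hM x)) + e.symm (η'.comp (topSMul nonpositive hM x))
    rw [LinearMap.add_comp, map_add]
  map_smul' c η := hom_ext fun x => by
    change e.symm ((c • η).comp (topSMul nonpositive hM x)) =
      c • e.symm (η.comp (topSMul nonpositive hM x))
    rw [LinearMap.smul_comp, map_smul]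

/-- The functional `η` is recovered from its morphism in `D(A)` by applying `H^m` and evaluating at
`1 ∈ A`. -/
lemma injective_Q_map_toDualTop (nonpositive : ∀ i : ℤ, 0 < i → A.gr i = ⊥)
    (e : (regular A).topCohomology 0 ≃ₗ[k] Module.Dual k ((regular A).topCohomology 0))
    {M : DGModule A} {m : ℤ}
    (hM : ∀ i, m < i → M.gr i = ⊥) : Function.Injective
      (((Q A).mapLinearMap k).comp (toDualTop nonpositive e hM)) := by
  refine (injective_iff_map_eq_zero _).2 fun η hη => ?_
  have h0 : cohomologyMap (toDualTop nonpositive e hM η) m = cohomologyMap 0 m :=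
    cohomologyMap_eq_of_Q_map_eq (hη.trans ((Q A).map_zero _ _).symm) m
  refine Submodule.linearMap_qext _ (LinearMap.ext fun x => ?_)
  have hadd : ∀ y z, η (Submodule.Quotient.mk y) = 0 → η (Submodule.Quotient.mk z) = 0 →
      η (Submodule.Quotient.mk (y + z)) = 0 := fun y z hy hz => by
    rw [Submodule.Quotient.mk_add, map_add, hy, hz, add_zero]
  refine gr_induction M (p := fun x => η (Submodule.Quotient.mk x) = 0) x (fun i y hy => ?_) hadd
  by_cases h : i = m
  · subst h
    have hd := M.d_mem hy
    rw [hM _ (by lia), Submodule.mem_bot] at hd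
    obtain ⟨w, -, hw⟩ := (Submodule.Quotient.mk_eq_zero _).1
      (LinearMap.congr_fun h0 (Submodule.Quotient.mk ⟨y, hy, hd⟩))
    have hz : e.symm (η.comp (topSMul nonpositive hM y)) = 0 := hw.symm
    have := LinearMap.congr_fun (e.symm.map_eq_zero_iff.1 hz)
      (Submodule.Quotient.mk (1 : A.carrier))
    rw [LinearMap.comp_apply, topSMul_mk] at this
    rwa [MulOpposite.op_one, one_smul] at this
  · rw [(Submodule.Quotient.mk_eq_zero _).2 (gr_le_topKernel M h hy), map_zero]

/-- The top cohomology of a perfect dg module is finite-dimensional. -/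
lemma finite_cohomology_of_per (nonpositive : ∀ i : ℤ, 0 < i → A.gr i = ⊥)
    (finite_H0 : Module.Finite k (A.cohomology 0)) {M : DGModule A} {m : ℤ}
    (hM : ∀ i, m < i → M.gr i = ⊥) (hper : per A ((Q A).obj M)) :
    Module.Finite k (M.cohomology m) := by
  have : Module.Finite k ((regular A).cohomology 0) := finite_H0
  have hV : Module.Finite k ((regular A).topCohomology 0) :=
    finite_top_of_finite_cohomology (regular A) (nonpositive _ (by lia))
  let e : (regular A).topCohomology 0 ≃ₗ[k] Module.Dual k ((regular A).topCohomology 0) :=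
    LinearEquiv.ofFinrankEq _ _ Subspace.dual_finrank_eq.symm
  have hY : LocallyFinite A ((Q A).obj (dualTop nonpositive e m)) := locallyFinite_Q_iff.2 fun i => by
    have : Module.Finite k (dualTop nonpositive e m).carrier := hV
    infer_instance
  have := per_le_homFinite _ hper _ hY
  have : Module.Finite k (Module.Dual k (M.topCohomology m)) :=
    Module.Finite.of_injective _ (injective_Q_map_toDualTop nonpositive e hM)
  have : Module.Finite k (M.topCohomology m) := Module.finite_dual_iff k |>.1 this
  exact finite_cohomology_of_finite_top M m

end TopCohomology

end DGModule

/-! ### Descending induction -/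

theorem propositionp {k : Type u} [Field k] (A : DGAlgebra.{u, v} k)
    (nonpositive : ∀ i : ℤ, 0 < i → A.gr i = ⊥)
    (finite_H0 : Module.Finite k (A.cohomology 0))
    (Dfd_le_per : DGModule.Dfd A ≤ DGModule.per A) :
    (∀ i : ℤ, Module.Finite k (A.cohomology i)) ∧
      ∀ X Y : DGModule.Derived A, DGModule.per A X → DGModule.per A Y →
        Module.Finite k (X ⟶ Y) := by
  have step : ∀ m : ℤ, (∀ i, m < i → Module.Finite k (A.cohomology i)) →
      Module.Finite k (A.cohomology m) := by
    intro m hm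
    obtain ⟨X, f, hf, hX, hfm⟩ := DGModule.exists_truncation nonpositive (DGModule.regular A) m
    have hC : DGModule.Dfd A ((DGModule.Q A).obj (DGModule.cone f)) :=
      ⟨_, DGModule.finite_dgTotalCohomology_cone f hf m 0 hX hfm nonpositive hm, ⟨Iso.refl _⟩⟩
    have hper := DGModule.per_source_of_cone f DGModule.per_regular (Dfd_le_per _ hC)
    have := DGModule.finite_cohomology_of_per nonpositive finite_H0 hX hper
    refine Module.Finite.of_surjective (DGModule.cohomologyMap f m) fun x => ?_
    obtain ⟨⟨a, ha, hda⟩, rfl⟩ := Submodule.Quotient.mk_surjective _ x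
    obtain ⟨y, hy, rfl⟩ := hfm m le_rfl a ha fun _ => hda
    refine ⟨Submodule.Quotient.mk ⟨y, hy, hf ?_⟩, rfl⟩
    rw [DGModule.Hom.comm, map_zero]
    exact hda
  have H : ∀ i : ℤ, Module.Finite k (A.cohomology i) := by
    have key : ∀ (n : ℕ) (i : ℤ), 0 < i + n → Module.Finite k (A.cohomology i) := by
      intro n
      induction n with
      | zero =>
        intro i hi
        have : Subsingleton (dgCocycles A.gr A.d i) := ⟨fun x y => Subtype.ext (by
          have hx := x.2.1
          have hy := y.2.1
          rw [nonpositive i (by lia)] at hx hy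
          exact ((Submodule.mem_bot k).1 hx).trans ((Submodule.mem_bot k).1 hy).symm)⟩
        infer_instance
      | succ n ih => exact fun i hi => step i fun j hj => ih j (by push_cast at hi; lia)
    exact fun i => key (1 - i).toNat i (by omega)
  refine ⟨H, fun X Y hX hY => DGModule.per_le_homFinite X hX Y ?_⟩
  exact DGModule.per_le DGModule.isThick_locallyFinite H Y hY

end
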